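/- **Data.** Fix a transition system: a set $\mathsf{State}$ of states, a set $\mathsf{Event}$ of events and, for all $\sigma,e,\sigma'$, a set $\mathsf{Step}(\sigma,e,\sigma')$ of transitions. A finite trace is a path in the graph of labelled transitions; $T_f$ is the category whose objects are the finite traces and whose morphisms $\epsilon:\tau\to\tau'$ are the extensions of $\tau$ to $\tau'$ (paths $\rho$ with $\tau\cdot\rho=\tau'$). Fix also a set of knowledge symbols $f$, each with a level $\ell_f\in\mathbb N$ and a presheaf $K_f:T_f^{op}\to\mathbf{Set}$. **The calculus DEKL** over these data is the dependent type theory with judgments $\vdash\Gamma\ \mathsf{ctx}$, $\Gamma\vdash t:A$ and $\Gamma\vdash t\equiv u:A$ generated by the following rules ($U$ ranges over the universes $\mathsf{Uc}_i$, $\mathsf{Type}_i$, $\mathsf{Prop}$; a type is a term $A$ with $\Gamma\vdash A:U$). 1. *Structure.* Empty context, context extension $\Gamma,x:A$ for $\Gamma\vdash A:U$, variables, conversion along $\Gamma\vdash A\equiv B:U$. Definitional equality is a congruence (equivalence relation, stable under conversion, substitution of equals for equals, congruence under binders). 2. *Universes.* $\mathsf{Uc}_i:\mathsf{Uc}_{i+1}$,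 $\mathsf{Type}_i:\mathsf{Type}_{i+1}$, $\mathsf{Prop}:\mathsf{Type}_0$, and cumulativity $\mathsf{Uc}_i\subseteq\mathsf{Uc}_{i+1}$, $\mathsf{Type}_i\subseteq\mathsf{Type}_{i+1}$, $\mathsf{Uc}_i\subseteq\mathsf{Type}_i$, $\mathsf{Prop}\subseteq\mathsf{Type}_0$. 3. *Products.* If $\Gamma\vdash A:U$ and $\Gamma,x:A\vdash B:U$ then $\Gamma\vdash\Pi(x:A).B:U$; also $\Pi(x:A).B:\mathsf{Prop}$ for $A:\mathsf{Uc}_i$ and $B:\mathsf{Prop}$. Abstraction, application, and $(\lambda x.b)\,a\equiv b[a/x]$. 4. *Falsum.* $\bot:U$ for every universe $U$, and $\mathsf{abort}(t):A$ for every type $A$ and $t:\bot$. 5. *Martin-Löf constructors*, with their usual introduction, elimination (into families in any universe) and computation rules: unit type and $\mathsf{Nat}$ in $\mathsf{Uc}_0$; $\Sigma$ (with both projections), binary sums and identity types in every $\mathsf{Uc}_i$ and $\mathsf{Type}_i$. 6. *Transition system.* $\mathsf{State},\mathsf{Event}:\mathsf{Uc}_0$ and $\mathsf{Step}(\sigma,e,\sigma'):\mathsf{Uc}_0$,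 with one constant for each state, event and transition. 7. *Finite traces.* $\mathsf{FinTrace}(\sigma,\sigma'):\mathsf{Uc}_0$; $\mathsf{nil}(\sigma):\mathsf{FinTrace}(\sigma,\sigma)$; $\mathsf{step}(\tau,e,\pi):\mathsf{FinTrace}(\sigma_0,\sigma_2)$ for $\tau:\mathsf{FinTrace}(\sigma_0,\sigma_1)$, $e:\mathsf{Event}$, $\pi:\mathsf{Step}(\sigma_1,e,\sigma_2)$; and, for every family $P(\sigma,\tau)$ in any universe over $\sigma:\mathsf{State}$, $\tau:\mathsf{FinTrace}(\sigma_0,\sigma)$, the dependent eliminator $\mathsf{trace\text{-}elim}$ with its computation rules on $\mathsf{nil}$ and $\mathsf{step}$. 8. *Infinite traces.* $\mathsf{InfTrace}:\mathsf{Uc}_0$ with $\mathsf{head}(t):\mathsf{State}$, $\mathsf{tail}(t):\mathsf{Event}\times\mathsf{InfTrace}$ and guarded corecursion: for a type $A$, $h:A\to\mathsf{State}$, $n:A\to\mathsf{Event}\times A$ and $a:A$, a term $\mathsf{corec}(h,n,a):\mathsf{InfTrace}$ with head $\equiv h\,a$ and tail $\equiv(\mathsf{fst}(n\,a),\mathsf{corec}(h,n,\mathsf{snd}(n\,a)))$.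 9. *Extensions.* $\mathsf{Ext}_f(\tau,\tau'):\mathsf{Uc}_0$ for finite traces $\tau,\tau'$ with the same source, with identities, the one-step extensions $\tau\to\mathsf{step}(\tau,e,\pi)$, composition, and the category laws as definitional equalities. 10. *Knowledge.* $K_f(\tau):\mathsf{Type}_{\ell_f}$; for each trace $\tau$ of the transition system a constant of type $K_f(\tau)$ for each element of the set $K_f(\tau)$; $\mathsf{restrict}(\epsilon,k):K_f(\tau)$ for $\epsilon:\mathsf{Ext}_f(\tau,\tau')$ and $k:K_f(\tau')$; $\mathsf{restrict}(id_\tau,k)\equiv k$; $\mathsf{restrict}(\epsilon_1\circ\epsilon_2,k)\equiv\mathsf{restrict}(\epsilon_1,\mathsf{restrict}(\epsilon_2,k))$ (composition in diagrammatic order); and on constants $\mathsf{restrict}$ along a one-step extension is the action of the presheaf $K_f$. 11. *Fixed points of propositions.* If $\Gamma,X:\mathsf{Prop}\vdash\varphi(X):\mathsf{Prop}$ is derivably monotone, i.e. $\Gamma,X:\mathsf{Prop},Y:\mathsf{Prop},h:X\to Y,z:\varphi(X)\vdash m:\varphi(Y)$ for some $m$, then $\mu X.\varphi$ and $\nu X.\varphi$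 are in $\mathsf{Prop}$, with rules $\varphi(\mu X.\varphi)\Rightarrow\mu X.\varphi$; $\mu X.\varphi\Rightarrow Q$ from $\varphi(Q)\to Q$; $\nu X.\varphi\Rightarrow\varphi(\nu X.\varphi)$; $Q\Rightarrow\nu X.\varphi$ from $Q\to\varphi(Q)$, for every $Q:\mathsf{Prop}$. **Theorem (Consistency).** For every transition system and every family of knowledge presheaves, there is no term $t$ such that $\vdash t:\bot$ is derivable in DEKL in the empty context. -/

import Mathlib

open CategoryTheory

universe u

namespace DEKL

/-! ## Transition systems, finite traces and knowledge presheaves -/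

/-- A transition system: states, events and (proof-relevant) one-step transitions. -/
structure TransitionSystem where
  State : Type u
  Event : Type u
  Step : State → Event → State → Type u

/-- The vertices of the transition graph. -/
def TransitionSystem.Graph (T : TransitionSystem.{u}) : Type u := T.State

/-- The edges of the transition graph are the labelled transitions. -/
instance (T : TransitionSystem.{u}) : Quiver T.Graph where
  Hom σ σ' := Σ e : T.Event, T.Step σ e σ'

/-- A finite trace: a path in the transition graph, together with its end points. -/
structure Trace (T : TransitionSystem.{u}) where
  src : T.Graph
  tgt : T.Graph
  path : Quiver.Path src tgt

/-- An extension `τ ⟶ τ'`: a path `ρ` such that `τ'` is `τ` followed by `ρ`. -/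
def Trace.Ext {T : TransitionSystem.{u}} (τ τ' : Trace T) : Type u :=
  { ρ : Quiver.Path τ.tgt τ'.tgt // Trace.mk τ.src τ'.tgt (τ.path.comp ρ) = τ' }

/-- The finite-trace category: objects are finite traces, morphisms are trace extensions. -/
instance (T : TransitionSystem.{u}) : Category.{u} (Trace T) where
  Hom τ τ' := τ.Ext τ'
  id τ := ⟨Quiver.Path.nil, rfl⟩
  comp {a b c} f g := ⟨f.1.comp g.1, by
    obtain ⟨f, hf⟩ := f
    obtain ⟨g, hg⟩ := g
    rw [← Quiver.Path.comp_assoc]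
    have key : ∀ (b' : Trace T) (h : Trace.mk a.src b.tgt (a.path.comp f) = b')
        (g' : Quiver.Path b'.tgt c.tgt) (_ : Trace.mk b'.src c.tgt (b'.path.comp g') = c)
        (_ : b' = b) (_ : HEq g' g),
        Trace.mk a.src c.tgt ((a.path.comp f).comp g) = c := by
      rintro b' rfl g' h1 - h3
      cases h3
      exact h1
    exact key b hf g hg rfl HEq.rfl⟩
  id_comp f := Subtype.ext (Quiver.Path.nil_comp _)
  comp_id f := Subtype.ext (Quiver.Path.comp_nil _)
  assoc f g h := Subtype.ext (Quiver.Path.comp_assoc _ _ _)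

/-- The trace `τ · e`, where the event `e` is performed by the transition `π`. -/
def Trace.snoc {T : TransitionSystem.{u}} (τ : Trace T) {e : T.Event} {σ : T.State}
    (π : T.Step τ.tgt e σ) : Trace T :=
  ⟨τ.src, σ, τ.path.cons ⟨e, π⟩⟩

/-- The one-step extension `τ ⟶ τ · e`. -/
def Trace.snocHom {T : TransitionSystem.{u}} (τ : Trace T) {e : T.Event} {σ : T.State}
    (π : T.Step τ.tgt e σ) : τ ⟶ τ.snoc π :=
  ⟨Quiver.Path.cons Quiver.Path.nil ⟨e, π⟩, rfl⟩

/-- The data over which the calculus is set up: a transition system, and knowledge family symbols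
`f`, each with a level `ℓ` (so that `K_f(τ) : Type_ℓ`) and a presheaf on the finite-trace
category. -/
structure Signature extends TransitionSystem.{u} where
  Know : Type u
  level : Know → ℕ
  K : Know → (Trace toTransitionSystem)ᵒᵖ ⥤ Type u

/-! ## Raw syntax -/

/-- The universes of the three layers: `Uc_i`, `Type_i` and `Prop`. -/
inductive Univ : Type
  | uc (i : ℕ)
  | ty (i : ℕ)
  | prop

/-- Raw terms and types, with de Bruijn indices. Binders: the second argument of `pi` and `sigma`,
and the argument of `lam`, `mu` and `nu`. -/
inductive Tm (S : Signature.{u}) : Type u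
  | var (n : ℕ)
  | univ (U : Univ)
  -- dependent products
  | pi (A B : Tm S)
  | lam (t : Tm S)
  | app (f a : Tm S)
  -- dependent sums
  | sigma (A B : Tm S)
  | pair (a b : Tm S)
  | fst (t : Tm S)
  | snd (t : Tm S)
  -- falsum
  | bot
  | abort (t : Tm S)
  -- unit
  | unit
  | star
  | unitRec (c t : Tm S)
  -- binary sums
  | sum (A B : Tm S)
  | inl (a : Tm S)
  | inr (b : Tm S)
  | case (f g t : Tm S)
  -- natural numbers
  | nat
  | zero
  | suc (n : Tm S)
  | natRec (z s n : Tm S)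
  -- identity types
  | id (A a b : Tm S)
  | refl
  | idRec (d p : Tm S)
  -- the transition system; one constant for each state, event and transition
  | state
  | event
  | stepTy (σ e σ' : Tm S)
  | stateC (σ : S.State)
  | eventC (e : S.Event)
  | stepC {σ : S.State} {e : S.Event} {σ' : S.State} (π : S.Step σ e σ')
  -- finite traces; `step σ₁ σ₂ τ e π` is `step(τ, e, π)` with its implicit end points
  | finTrace (σ σ' : Tm S)
  | nil (σ : Tm S)
  | step (σ₁ σ₂ τ e π : Tm S)
  | traceElim (b s τ : Tm S)
  -- infinite traces
  | infTrace
  | head (t : Tm S)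
  | tail (t : Tm S)
  | corec (h n a : Tm S)
  -- trace extensions
  | ext (τ τ' : Tm S)
  | extId
  | extStep (e π : Tm S)
  | extComp (ε₁ ε₂ : Tm S)
  -- trace-indexed knowledge; one constant for each element of each `K_f(τ)`
  | know (f : S.Know) (τ : Tm S)
  | knowC (f : S.Know) (τ : Trace S.toTransitionSystem) (k : (S.K f).obj (Opposite.op τ))
  | restrict (ε k : Tm S)
  -- least and greatest fixed points of operators on propositions
  | mu (φ : Tm S)
  | muIn (t : Tm S)
  | muInd (s t : Tm S)
  | nu (φ : Tm S)
  | nuOut (t : Tm S)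
  | nuCoind (s t : Tm S)

namespace Tm

variable {S : Signature.{u}}

/-- Lift a renaming under a binder. -/
def upRen (ρ : ℕ → ℕ) : ℕ → ℕ
  | 0 => 0
  | n + 1 => ρ n + 1

/-- Renaming of variables. -/
def rename (ρ : ℕ → ℕ) : Tm S → Tm S
  | var n => var (ρ n)
  | univ U => univ U
  | pi A B => pi (A.rename ρ) (B.rename (upRen ρ))
  | lam t => lam (t.rename (upRen ρ))
  | app f a => app (f.rename ρ) (a.rename ρ)
  | sigma A B => sigma (A.rename ρ) (B.rename (upRen ρ))
  | pair a b => pair (a.rename ρ) (b.rename ρ)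
  | fst t => fst (t.rename ρ)
  | snd t => snd (t.rename ρ)
  | bot => bot
  | abort t => abort (t.rename ρ)
  | unit => unit
  | star => star
  | unitRec c t => unitRec (c.rename ρ) (t.rename ρ)
  | sum A B => sum (A.rename ρ) (B.rename ρ)
  | inl a => inl (a.rename ρ)
  | inr b => inr (b.rename ρ)
  | case f g t => case (f.rename ρ) (g.rename ρ) (t.rename ρ)
  | nat => nat
  | zero => zero
  | suc n => suc (n.rename ρ)
  | natRec z s n => natRec (z.rename ρ) (s.rename ρ) (n.rename ρ)
  | id A a b => id (A.rename ρ) (a.rename ρ) (b.rename ρ)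
  | refl => refl
  | idRec d p => idRec (d.rename ρ) (p.rename ρ)
  | state => state
  | event => event
  | stepTy σ e σ' => stepTy (σ.rename ρ) (e.rename ρ) (σ'.rename ρ)
  | stateC σ => stateC σ
  | eventC e => eventC e
  | stepC π => stepC π
  | finTrace σ σ' => finTrace (σ.rename ρ) (σ'.rename ρ)
  | nil σ => nil (σ.rename ρ)
  | step σ₁ σ₂ τ e π =>
      step (σ₁.rename ρ) (σ₂.rename ρ) (τ.rename ρ) (e.rename ρ) (π.rename ρ)
  | traceElim b s τ => traceElim (b.rename ρ) (s.rename ρ) (τ.rename ρ)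
  | infTrace => infTrace
  | head t => head (t.rename ρ)
  | tail t => tail (t.rename ρ)
  | corec h n a => corec (h.rename ρ) (n.rename ρ) (a.rename ρ)
  | ext τ τ' => ext (τ.rename ρ) (τ'.rename ρ)
  | extId => extId
  | extStep e π => extStep (e.rename ρ) (π.rename ρ)
  | extComp ε₁ ε₂ => extComp (ε₁.rename ρ) (ε₂.rename ρ)
  | know f τ => know f (τ.rename ρ)
  | knowC f τ k => knowC f τ k
  | restrict ε k => restrict (ε.rename ρ) (k.rename ρ)
  | mu φ => mu (φ.rename (upRen ρ))
  | muIn t => muIn (t.rename ρ)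
  | muInd s t => muInd (s.rename ρ) (t.rename ρ)
  | nu φ => nu (φ.rename (upRen ρ))
  | nuOut t => nuOut (t.rename ρ)
  | nuCoind s t => nuCoind (s.rename ρ) (t.rename ρ)

/-- Weakening by `n` variables. -/
def shift (n : ℕ) (t : Tm S) : Tm S := t.rename (· + n)

/-- The substitution that sends variable `0` to `a` and variable `n + 1` to `θ n`. -/
def scons (a : Tm S) (θ : ℕ → Tm S) : ℕ → Tm S
  | 0 => a
  | n + 1 => θ n

/-- Lift a substitution under a binder. -/
def up (θ : ℕ → Tm S) : ℕ → Tm S := scons (var 0) fun n => (θ n).shift 1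

/-- Simultaneous substitution. -/
def subst (θ : ℕ → Tm S) : Tm S → Tm S
  | var n => θ n
  | univ U => univ U
  | pi A B => pi (A.subst θ) (B.subst (up θ))
  | lam t => lam (t.subst (up θ))
  | app f a => app (f.subst θ) (a.subst θ)
  | sigma A B => sigma (A.subst θ) (B.subst (up θ))
  | pair a b => pair (a.subst θ) (b.subst θ)
  | fst t => fst (t.subst θ)
  | snd t => snd (t.subst θ)
  | bot => bot
  | abort t => abort (t.subst θ)
  | unit => unit
  | star => star
  | unitRec c t => unitRec (c.subst θ) (t.subst θ)
  | sum A B => sum (A.subst θ) (B.subst θ)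
  | inl a => inl (a.subst θ)
  | inr b => inr (b.subst θ)
  | case f g t => case (f.subst θ) (g.subst θ) (t.subst θ)
  | nat => nat
  | zero => zero
  | suc n => suc (n.subst θ)
  | natRec z s n => natRec (z.subst θ) (s.subst θ) (n.subst θ)
  | id A a b => id (A.subst θ) (a.subst θ) (b.subst θ)
  | refl => refl
  | idRec d p => idRec (d.subst θ) (p.subst θ)
  | state => state
  | event => event
  | stepTy σ e σ' => stepTy (σ.subst θ) (e.subst θ) (σ'.subst θ)
  | stateC σ => stateC σ
  | eventC e => eventC e
  | stepC π => stepC π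
  | finTrace σ σ' => finTrace (σ.subst θ) (σ'.subst θ)
  | nil σ => nil (σ.subst θ)
  | step σ₁ σ₂ τ e π =>
      step (σ₁.subst θ) (σ₂.subst θ) (τ.subst θ) (e.subst θ) (π.subst θ)
  | traceElim b s τ => traceElim (b.subst θ) (s.subst θ) (τ.subst θ)
  | infTrace => infTrace
  | head t => head (t.subst θ)
  | tail t => tail (t.subst θ)
  | corec h n a => corec (h.subst θ) (n.subst θ) (a.subst θ)
  | ext τ τ' => ext (τ.subst θ) (τ'.subst θ)
  | extId => extId
  | extStep e π => extStep (e.subst θ) (π.subst θ)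
  | extComp ε₁ ε₂ => extComp (ε₁.subst θ) (ε₂.subst θ)
  | know f τ => know f (τ.subst θ)
  | knowC f τ k => knowC f τ k
  | restrict ε k => restrict (ε.subst θ) (k.subst θ)
  | mu φ => mu (φ.subst (up θ))
  | muIn t => muIn (t.subst θ)
  | muInd s t => muInd (s.subst θ) (t.subst θ)
  | nu φ => nu (φ.subst (up θ))
  | nuOut t => nuOut (t.subst θ)
  | nuCoind s t => nuCoind (s.subst θ) (t.subst θ)

/-- `B.inst a` is `B[a/x]`, where `x` is the last variable (index `0`). -/
def inst (B a : Tm S) : Tm S := B.subst (scons a var)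

/-- `C.inst₂ a b` is `C[a/x, b/y]`, where `y` is the last variable and `x` the one before. -/
def inst₂ (C a b : Tm S) : Tm S := C.subst (scons b (scons a var))

/-- The non-dependent function type `A → B`. -/
def arrow (A B : Tm S) : Tm S := pi A (B.shift 1)

/-- The binary product `A × B`. -/
def prod (A B : Tm S) : Tm S := sigma A (B.shift 1)

/-- The type `Π(n : Nat). P(n) → P(suc n)`. -/
def natStepTy (P : Tm S) : Tm S :=
  pi nat (pi P (P.subst (scons (suc (var 1)) fun k => var (k + 2))))

/-- The type of the step case of trace elimination, for the motive `P(σ, τ)` on traces starting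
at `σ₀`:
`Π(σ₁ : State)(τ : FinTrace(σ₀, σ₁))(e : Event)(σ₂ : State)(π : Step(σ₁, e, σ₂)).`
`P(σ₁, τ) → P(σ₂, step(τ, e, π))`. -/
def traceStepTy (σ₀ P : Tm S) : Tm S :=
  pi state <| pi (finTrace (σ₀.shift 1) (var 0)) <| pi event <| pi state <|
    pi (stepTy (var 3) (var 1) (var 0)) <|
      pi (P.subst (scons (var 3) (scons (var 4) fun k => var (k + 5)))) <|
        P.subst (scons (step (var 5) (var 2) (var 4) (var 3) (var 1))
          (scons (var 2) fun k => var (k + 6)))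

/-- The closed term that denotes a path of the transition graph. -/
def quotePath {σ₀ : S.Graph} : {σ : S.Graph} → Quiver.Path σ₀ σ → Tm S
  | _, Quiver.Path.nil => nil (stateC σ₀)
  | σ₂, @Quiver.Path.cons _ _ _ σ₁ _ p f =>
      step (stateC σ₁) (stateC σ₂) (quotePath p) (eventC f.1) (stepC f.2)

/-- The closed term that denotes a finite trace. -/
def quote (τ : Trace S.toTransitionSystem) : Tm S := quotePath τ.path

end Tm

/-! ## Judgments and rules -/

/-- Contexts; the head of the list is the type of the last variable, and each entry lives in the
context formed by the entries after it. -/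
abbrev Ctx (S : Signature.{u}) : Type u := List (Tm S)

/-- `Lookup Γ n A`: variable `n` is declared in `Γ`, and its type, weakened to `Γ`, is `A`. -/
inductive Lookup {S : Signature.{u}} : Ctx S → ℕ → Tm S → Prop
  | zero (Γ : Ctx S) (A : Tm S) : Lookup (A :: Γ) 0 (A.shift 1)
  | succ {Γ : Ctx S} {n : ℕ} {A : Tm S} (B : Tm S) :
      Lookup Γ n A → Lookup (B :: Γ) (n + 1) (A.shift 1)

/-- `MemUniv U V`: the universe `U` is an element of the universe `V`. -/
inductive MemUniv : Univ → Univ → Prop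
  | uc (i : ℕ) : MemUniv (.uc i) (.uc (i + 1))
  | ty (i : ℕ) : MemUniv (.ty i) (.ty (i + 1))
  | prop : MemUniv .prop (.ty 0)

/-- `Cumul U V`: every type in `U` is also a type in `V`. -/
inductive Cumul : Univ → Univ → Prop
  | uc (i : ℕ) : Cumul (.uc i) (.uc (i + 1))
  | ty (i : ℕ) : Cumul (.ty i) (.ty (i + 1))
  | ucTy (i : ℕ) : Cumul (.uc i) (.ty i)
  | prop : Cumul .prop (.ty 0)

/-- The judgments `⊢ Γ ctx`, `Γ ⊢ t : A` and `Γ ⊢ t ≡ u : A`. Types are the terms `A` with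
`Γ ⊢ A : U` for a universe `U`. -/
inductive Judgment (S : Signature.{u}) : Type u
  | ctx (Γ : Ctx S)
  | tm (Γ : Ctx S) (t A : Tm S)
  | eq (Γ : Ctx S) (t s A : Tm S)

open Tm Judgment in
/-- Derivable judgments. -/
inductive Derivable {S : Signature.{u}} : Judgment S → Prop
  -- contexts, variables, conversion
  | ctx_empty : Derivable (ctx [])
  | ctx_ext {Γ A U} : Derivable (ctx Γ) → Derivable (tm Γ A (univ U)) → Derivable (ctx (A :: Γ))
  | var {Γ n A} : Derivable (ctx Γ) → Lookup Γ n A → Derivable (tm Γ (var n) A)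
  | conv {Γ t A B U} : Derivable (tm Γ t A) → Derivable (eq Γ A B (univ U)) →
      Derivable (tm Γ t B)
  -- definitional equality
  | eq_refl {Γ t A} : Derivable (tm Γ t A) → Derivable (eq Γ t t A)
  | eq_symm {Γ t s A} : Derivable (eq Γ t s A) → Derivable (eq Γ s t A)
  | eq_trans {Γ t s r A} : Derivable (eq Γ t s A) → Derivable (eq Γ s r A) →
      Derivable (eq Γ t r A)
  | eq_conv {Γ t s A B U} : Derivable (eq Γ t s A) → Derivable (eq Γ A B (univ U)) →
      Derivable (eq Γ t s B)
  -- equals may be substituted for equals in every term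
  | eq_subst {Γ A B t a a'} : Derivable (tm (A :: Γ) t B) → Derivable (eq Γ a a' A) →
      Derivable (eq Γ (t.inst a) (t.inst a') (B.inst a))
  -- congruence under binders
  | pi_congr {Γ A A' B B' U} : Derivable (eq Γ A A' (univ U)) →
      Derivable (eq (A :: Γ) B B' (univ U)) → Derivable (eq Γ (pi A B) (pi A' B') (univ U))
  | all_congr {Γ A A' B B' i} : Derivable (eq Γ A A' (univ (.uc i))) →
      Derivable (eq (A :: Γ) B B' (univ .prop)) →
      Derivable (eq Γ (pi A B) (pi A' B') (univ .prop))
  | lam_congr {Γ A B t t'} : Derivable (eq (A :: Γ) t t' B) →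
      Derivable (eq Γ (lam t) (lam t') (pi A B))
  | sigma_congr {Γ A A' B B' U} : U ≠ .prop → Derivable (eq Γ A A' (univ U)) →
      Derivable (eq (A :: Γ) B B' (univ U)) →
      Derivable (eq Γ (sigma A B) (sigma A' B') (univ U))
  | mu_congr {Γ φ φ'} : Derivable (tm Γ (mu φ) (univ .prop)) →
      Derivable (eq (univ .prop :: Γ) φ φ' (univ .prop)) →
      Derivable (eq Γ (mu φ) (mu φ') (univ .prop))
  | nu_congr {Γ φ φ'} : Derivable (tm Γ (nu φ) (univ .prop)) →
      Derivable (eq (univ .prop :: Γ) φ φ' (univ .prop)) →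
      Derivable (eq Γ (nu φ) (nu φ') (univ .prop))
  -- universes
  | univ_form {Γ U V} : Derivable (ctx Γ) → MemUniv U V →
      Derivable (tm Γ (univ U) (univ V))
  | cumul {Γ A U V} : Derivable (tm Γ A (univ U)) → Cumul U V → Derivable (tm Γ A (univ V))
  -- dependent products
  | pi_form {Γ A B U} : Derivable (tm Γ A (univ U)) → Derivable (tm (A :: Γ) B (univ U)) →
      Derivable (tm Γ (pi A B) (univ U))
  -- propositions are also closed under quantification over computational types
  | all_form {Γ A B i} : Derivable (tm Γ A (univ (.uc i))) →
      Derivable (tm (A :: Γ) B (univ .prop)) → Derivable (tm Γ (pi A B) (univ .prop))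
  | pi_intro {Γ A B t} : Derivable (tm (A :: Γ) t B) → Derivable (tm Γ (lam t) (pi A B))
  | pi_elim {Γ A B f a} : Derivable (tm Γ f (pi A B)) → Derivable (tm Γ a A) →
      Derivable (tm Γ (app f a) (B.inst a))
  | pi_beta {Γ A B a b} : Derivable (tm Γ a A) → Derivable (tm (A :: Γ) b B) →
      Derivable (eq Γ (app (lam b) a) (b.inst a) (B.inst a))
  -- dependent sums
  | sigma_form {Γ A B U} : U ≠ .prop → Derivable (tm Γ A (univ U)) →
      Derivable (tm (A :: Γ) B (univ U)) → Derivable (tm Γ (sigma A B) (univ U))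
  | sigma_intro {Γ A B a b U} : Derivable (tm Γ (sigma A B) (univ U)) →
      Derivable (tm Γ a A) → Derivable (tm Γ b (B.inst a)) →
      Derivable (tm Γ (pair a b) (sigma A B))
  | fst {Γ A B t} : Derivable (tm Γ t (sigma A B)) → Derivable (tm Γ (fst t) A)
  | snd {Γ A B t} : Derivable (tm Γ t (sigma A B)) →
      Derivable (tm Γ (snd t) (B.inst (fst t)))
  | fst_pair {Γ A B a b U} : Derivable (tm Γ (sigma A B) (univ U)) →
      Derivable (tm Γ a A) → Derivable (tm Γ b (B.inst a)) →
      Derivable (eq Γ (fst (pair a b)) a A)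
  | snd_pair {Γ A B a b U} : Derivable (tm Γ (sigma A B) (univ U)) →
      Derivable (tm Γ a A) → Derivable (tm Γ b (B.inst a)) →
      Derivable (eq Γ (snd (pair a b)) b (B.inst a))
  -- falsum, available in every universe
  | bot_form {Γ} (U : Univ) : Derivable (ctx Γ) → Derivable (tm Γ bot (univ U))
  | bot_elim {Γ A t U} : Derivable (tm Γ A (univ U)) → Derivable (tm Γ t bot) →
      Derivable (tm Γ (abort t) A)
  -- unit
  | unit_form {Γ} : Derivable (ctx Γ) → Derivable (tm Γ unit (univ (.uc 0)))
  | unit_intro {Γ} : Derivable (ctx Γ) → Derivable (tm Γ star unit)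
  | unit_elim {Γ C c t U} : Derivable (tm (unit :: Γ) C (univ U)) →
      Derivable (tm Γ c (C.inst star)) → Derivable (tm Γ t unit) →
      Derivable (tm Γ (unitRec c t) (C.inst t))
  | unit_beta {Γ C c U} : Derivable (tm (unit :: Γ) C (univ U)) →
      Derivable (tm Γ c (C.inst star)) →
      Derivable (eq Γ (unitRec c star) c (C.inst star))
  -- binary sums
  | sum_form {Γ A B U} : U ≠ .prop → Derivable (tm Γ A (univ U)) →
      Derivable (tm Γ B (univ U)) → Derivable (tm Γ (sum A B) (univ U))
  | inl {Γ A B a U} : Derivable (tm Γ (sum A B) (univ U)) → Derivable (tm Γ a A) →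
      Derivable (tm Γ (inl a) (sum A B))
  | inr {Γ A B b U} : Derivable (tm Γ (sum A B) (univ U)) → Derivable (tm Γ b B) →
      Derivable (tm Γ (inr b) (sum A B))
  | sum_elim {Γ A B C f g t U} : Derivable (tm (sum A B :: Γ) C (univ U)) →
      Derivable (tm Γ f (pi A (C.subst (scons (inl (var 0)) fun k => var (k + 1))))) →
      Derivable (tm Γ g (pi B (C.subst (scons (inr (var 0)) fun k => var (k + 1))))) →
      Derivable (tm Γ t (sum A B)) → Derivable (tm Γ (case f g t) (C.inst t))
  | sum_beta_inl {Γ A B C f g a U} : Derivable (tm (sum A B :: Γ) C (univ U)) →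
      Derivable (tm Γ f (pi A (C.subst (scons (inl (var 0)) fun k => var (k + 1))))) →
      Derivable (tm Γ g (pi B (C.subst (scons (inr (var 0)) fun k => var (k + 1))))) →
      Derivable (tm Γ a A) →
      Derivable (eq Γ (case f g (inl a)) (app f a) (C.inst (inl a)))
  | sum_beta_inr {Γ A B C f g b U} : Derivable (tm (sum A B :: Γ) C (univ U)) →
      Derivable (tm Γ f (pi A (C.subst (scons (inl (var 0)) fun k => var (k + 1))))) →
      Derivable (tm Γ g (pi B (C.subst (scons (inr (var 0)) fun k => var (k + 1))))) →
      Derivable (tm Γ b B) →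
      Derivable (eq Γ (case f g (inr b)) (app g b) (C.inst (inr b)))
  -- natural numbers
  | nat_form {Γ} : Derivable (ctx Γ) → Derivable (tm Γ nat (univ (.uc 0)))
  | nat_zero {Γ} : Derivable (ctx Γ) → Derivable (tm Γ zero nat)
  | nat_suc {Γ n} : Derivable (tm Γ n nat) → Derivable (tm Γ (suc n) nat)
  | nat_elim {Γ P z s n U} : Derivable (tm (nat :: Γ) P (univ U)) →
      Derivable (tm Γ z (P.inst zero)) → Derivable (tm Γ s (natStepTy P)) →
      Derivable (tm Γ n nat) → Derivable (tm Γ (natRec z s n) (P.inst n))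
  | nat_beta_zero {Γ P z s U} : Derivable (tm (nat :: Γ) P (univ U)) →
      Derivable (tm Γ z (P.inst zero)) → Derivable (tm Γ s (natStepTy P)) →
      Derivable (eq Γ (natRec z s zero) z (P.inst zero))
  | nat_beta_suc {Γ P z s n U} : Derivable (tm (nat :: Γ) P (univ U)) →
      Derivable (tm Γ z (P.inst zero)) → Derivable (tm Γ s (natStepTy P)) →
      Derivable (tm Γ n nat) →
      Derivable (eq Γ (natRec z s (suc n)) (app (app s n) (natRec z s n)) (P.inst (suc n)))
  -- identity types
  | id_form {Γ A a b U} : U ≠ .prop → Derivable (tm Γ A (univ U)) → Derivable (tm Γ a A) →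
      Derivable (tm Γ b A) → Derivable (tm Γ (id A a b) (univ U))
  | id_refl {Γ A a} : Derivable (tm Γ a A) → Derivable (tm Γ refl (id A a a))
  | id_elim {Γ A a b C d p U} :
      Derivable (tm (id (A.shift 1) (a.shift 1) (.var 0) :: A :: Γ) C (univ U)) →
      Derivable (tm Γ d (C.inst₂ a refl)) → Derivable (tm Γ b A) →
      Derivable (tm Γ p (id A a b)) → Derivable (tm Γ (idRec d p) (C.inst₂ b p))
  | id_beta {Γ A a C d U} :
      Derivable (tm (id (A.shift 1) (a.shift 1) (.var 0) :: A :: Γ) C (univ U)) →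
      Derivable (tm Γ d (C.inst₂ a refl)) → Derivable (tm Γ a A) →
      Derivable (eq Γ (idRec d refl) d (C.inst₂ a refl))
  -- states, events, transitions
  | state_form {Γ} : Derivable (ctx Γ) → Derivable (tm Γ state (univ (.uc 0)))
  | event_form {Γ} : Derivable (ctx Γ) → Derivable (tm Γ event (univ (.uc 0)))
  | step_form {Γ σ e σ'} : Derivable (tm Γ σ state) → Derivable (tm Γ e event) →
      Derivable (tm Γ σ' state) → Derivable (tm Γ (stepTy σ e σ') (univ (.uc 0)))
  | state_const {Γ} (σ : S.State) : Derivable (ctx Γ) → Derivable (tm Γ (stateC σ) state)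
  | event_const {Γ} (e : S.Event) : Derivable (ctx Γ) → Derivable (tm Γ (eventC e) event)
  | step_const {Γ} {σ : S.State} {e : S.Event} {σ' : S.State} (π : S.Step σ e σ') :
      Derivable (ctx Γ) →
      Derivable (tm Γ (stepC π) (stepTy (stateC σ) (eventC e) (stateC σ')))
  -- finite traces
  | finTrace_form {Γ σ σ'} : Derivable (tm Γ σ state) → Derivable (tm Γ σ' state) →
      Derivable (tm Γ (finTrace σ σ') (univ (.uc 0)))
  | trace_nil {Γ σ} : Derivable (tm Γ σ state) → Derivable (tm Γ (nil σ) (finTrace σ σ))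
  | trace_step {Γ σ₀ σ₁ σ₂ τ e π} : Derivable (tm Γ σ₁ state) → Derivable (tm Γ σ₂ state) →
      Derivable (tm Γ τ (finTrace σ₀ σ₁)) → Derivable (tm Γ e event) →
      Derivable (tm Γ π (stepTy σ₁ e σ₂)) →
      Derivable (tm Γ (step σ₁ σ₂ τ e π) (finTrace σ₀ σ₂))
  | trace_elim {Γ σ₀ σ τ P b s U} : Derivable (tm Γ σ₀ state) → Derivable (tm Γ σ state) →
      Derivable (tm (finTrace (σ₀.shift 1) (.var 0) :: state :: Γ) P (univ U)) →
      Derivable (tm Γ b (P.inst₂ σ₀ (nil σ₀))) → Derivable (tm Γ s (traceStepTy σ₀ P)) →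
      Derivable (tm Γ τ (finTrace σ₀ σ)) → Derivable (tm Γ (traceElim b s τ) (P.inst₂ σ τ))
  | trace_beta_nil {Γ σ₀ P b s U} : Derivable (tm Γ σ₀ state) →
      Derivable (tm (finTrace (σ₀.shift 1) (.var 0) :: state :: Γ) P (univ U)) →
      Derivable (tm Γ b (P.inst₂ σ₀ (nil σ₀))) → Derivable (tm Γ s (traceStepTy σ₀ P)) →
      Derivable (eq Γ (traceElim b s (nil σ₀)) b (P.inst₂ σ₀ (nil σ₀)))
  | trace_beta_step {Γ σ₀ σ₁ σ₂ τ e π P b s U} : Derivable (tm Γ σ₀ state) →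
      Derivable (tm (finTrace (σ₀.shift 1) (.var 0) :: state :: Γ) P (univ U)) →
      Derivable (tm Γ b (P.inst₂ σ₀ (nil σ₀))) → Derivable (tm Γ s (traceStepTy σ₀ P)) →
      Derivable (tm Γ σ₁ state) → Derivable (tm Γ σ₂ state) →
      Derivable (tm Γ τ (finTrace σ₀ σ₁)) → Derivable (tm Γ e event) →
      Derivable (tm Γ π (stepTy σ₁ e σ₂)) →
      Derivable (eq Γ (traceElim b s (step σ₁ σ₂ τ e π))
        (app (app (app (app (app (app s σ₁) τ) e) σ₂) π) (traceElim b s τ))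
        (P.inst₂ σ₂ (step σ₁ σ₂ τ e π)))
  -- infinite traces; guarded corecursion is the coiteration of a coalgebra
  | infTrace_form {Γ} : Derivable (ctx Γ) → Derivable (tm Γ infTrace (univ (.uc 0)))
  | inf_head {Γ t} : Derivable (tm Γ t infTrace) → Derivable (tm Γ (head t) state)
  | inf_tail {Γ t} : Derivable (tm Γ t infTrace) →
      Derivable (tm Γ (tail t) (prod event infTrace))
  | inf_corec {Γ A h n a U} : Derivable (tm Γ A (univ U)) → Derivable (tm Γ h (arrow A state)) →
      Derivable (tm Γ n (arrow A (prod event A))) → Derivable (tm Γ a A) →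
      Derivable (tm Γ (corec h n a) infTrace)
  | inf_beta_head {Γ A h n a U} : Derivable (tm Γ A (univ U)) →
      Derivable (tm Γ h (arrow A state)) → Derivable (tm Γ n (arrow A (prod event A))) →
      Derivable (tm Γ a A) → Derivable (eq Γ (head (corec h n a)) (app h a) state)
  | inf_beta_tail {Γ A h n a U} : Derivable (tm Γ A (univ U)) →
      Derivable (tm Γ h (arrow A state)) → Derivable (tm Γ n (arrow A (prod event A))) →
      Derivable (tm Γ a A) →
      Derivable (eq Γ (tail (corec h n a))
        (pair (fst (app n a)) (corec h n (snd (app n a)))) (prod event infTrace))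
  -- trace extensions
  | ext_form {Γ σ₀ σ₁ σ₂ τ τ'} : Derivable (tm Γ τ (finTrace σ₀ σ₁)) →
      Derivable (tm Γ τ' (finTrace σ₀ σ₂)) → Derivable (tm Γ (ext τ τ') (univ (.uc 0)))
  | ext_id {Γ σ₀ σ₁ τ} : Derivable (tm Γ τ (finTrace σ₀ σ₁)) →
      Derivable (tm Γ extId (ext τ τ))
  | ext_step {Γ σ₀ σ₁ σ₂ τ e π} : Derivable (tm Γ σ₁ state) → Derivable (tm Γ σ₂ state) →
      Derivable (tm Γ τ (finTrace σ₀ σ₁)) → Derivable (tm Γ e event) →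
      Derivable (tm Γ π (stepTy σ₁ e σ₂)) →
      Derivable (tm Γ (extStep e π) (ext τ (step σ₁ σ₂ τ e π)))
  -- composition is written in diagrammatic order
  | ext_comp {Γ τ₁ τ₂ τ₃ ε₁ ε₂} : Derivable (tm Γ ε₁ (ext τ₁ τ₂)) →
      Derivable (tm Γ ε₂ (ext τ₂ τ₃)) → Derivable (tm Γ (extComp ε₁ ε₂) (ext τ₁ τ₃))
  | ext_id_comp {Γ τ₁ τ₂ ε} : Derivable (tm Γ ε (ext τ₁ τ₂)) →
      Derivable (eq Γ (extComp extId ε) ε (ext τ₁ τ₂))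
  | ext_comp_id {Γ τ₁ τ₂ ε} : Derivable (tm Γ ε (ext τ₁ τ₂)) →
      Derivable (eq Γ (extComp ε extId) ε (ext τ₁ τ₂))
  | ext_assoc {Γ τ₁ τ₂ τ₃ τ₄ ε₁ ε₂ ε₃} : Derivable (tm Γ ε₁ (ext τ₁ τ₂)) →
      Derivable (tm Γ ε₂ (ext τ₂ τ₃)) → Derivable (tm Γ ε₃ (ext τ₃ τ₄)) →
      Derivable (eq Γ (extComp (extComp ε₁ ε₂) ε₃) (extComp ε₁ (extComp ε₂ ε₃)) (ext τ₁ τ₄))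
  -- trace-indexed knowledge and restriction
  | know_form {Γ σ₀ σ₁ τ} (f : S.Know) : Derivable (tm Γ τ (finTrace σ₀ σ₁)) →
      Derivable (tm Γ (know f τ) (univ (.ty (S.level f))))
  | know_const {Γ} (f : S.Know) (τ : Trace S.toTransitionSystem)
      (k : (S.K f).obj (Opposite.op τ)) : Derivable (ctx Γ) →
      Derivable (tm Γ (knowC f τ k) (know f (quote τ)))
  | know_restrict {Γ f τ τ' ε k} : Derivable (tm Γ ε (ext τ τ')) →
      Derivable (tm Γ k (know f τ')) → Derivable (tm Γ (restrict ε k) (know f τ))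
  | restrict_id {Γ f τ k} : Derivable (tm Γ k (know f τ)) →
      Derivable (eq Γ (restrict extId k) k (know f τ))
  | restrict_comp {Γ f τ₁ τ₂ τ₃ ε₁ ε₂ k} : Derivable (tm Γ ε₁ (ext τ₁ τ₂)) →
      Derivable (tm Γ ε₂ (ext τ₂ τ₃)) → Derivable (tm Γ k (know f τ₃)) →
      Derivable (eq Γ (restrict (extComp ε₁ ε₂) k) (restrict ε₁ (restrict ε₂ k)) (know f τ₁))
  -- on the constants, restriction along a one-step extension is the action of the presheaf
  | restrict_const {Γ} (f : S.Know) (τ : Trace S.toTransitionSystem) {e : S.Event}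
      {σ : S.State} (π : S.Step τ.tgt e σ) (k : (S.K f).obj (Opposite.op (τ.snoc π))) :
      Derivable (ctx Γ) →
      Derivable (eq Γ (restrict (extStep (eventC e) (stepC π)) (knowC f (τ.snoc π) k))
        (knowC f τ ((S.K f).map (τ.snocHom π).op k)) (know f (quote τ)))
  -- fixed points of operators `X ↦ φ(X)` on propositions that are provably monotone: the premise
  -- on `m` is `Γ, X : Prop, Y : Prop, h : X → Y, z : φ(X) ⊢ m : φ(Y)`
  | mu_form {Γ φ m} : Derivable (tm (univ .prop :: Γ) φ (univ .prop)) →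
      Derivable (tm (φ.rename (· + 2) :: arrow (.var 1) (.var 0) :: univ .prop :: univ .prop :: Γ) m
        (φ.subst (scons (.var 2) fun k => .var (k + 4)))) →
      Derivable (tm Γ (mu φ) (univ .prop))
  | mu_in {Γ φ m t} : Derivable (tm (univ .prop :: Γ) φ (univ .prop)) →
      Derivable (tm (φ.rename (· + 2) :: arrow (.var 1) (.var 0) :: univ .prop :: univ .prop :: Γ) m
        (φ.subst (scons (.var 2) fun k => .var (k + 4)))) →
      Derivable (tm Γ t (φ.inst (mu φ))) → Derivable (tm Γ (muIn t) (mu φ))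
  | mu_ind {Γ φ m Q s t} : Derivable (tm (univ .prop :: Γ) φ (univ .prop)) →
      Derivable (tm (φ.rename (· + 2) :: arrow (.var 1) (.var 0) :: univ .prop :: univ .prop :: Γ) m
        (φ.subst (scons (.var 2) fun k => .var (k + 4)))) →
      Derivable (tm Γ Q (univ .prop)) → Derivable (tm Γ s (arrow (φ.inst Q) Q)) →
      Derivable (tm Γ t (mu φ)) → Derivable (tm Γ (muInd s t) Q)
  | nu_form {Γ φ m} : Derivable (tm (univ .prop :: Γ) φ (univ .prop)) →
      Derivable (tm (φ.rename (· + 2) :: arrow (.var 1) (.var 0) :: univ .prop :: univ .prop :: Γ) m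
        (φ.subst (scons (.var 2) fun k => .var (k + 4)))) →
      Derivable (tm Γ (nu φ) (univ .prop))
  | nu_out {Γ φ m t} : Derivable (tm (univ .prop :: Γ) φ (univ .prop)) →
      Derivable (tm (φ.rename (· + 2) :: arrow (.var 1) (.var 0) :: univ .prop :: univ .prop :: Γ) m
        (φ.subst (scons (.var 2) fun k => .var (k + 4)))) →
      Derivable (tm Γ t (nu φ)) → Derivable (tm Γ (nuOut t) (φ.inst (nu φ)))
  | nu_coind {Γ φ m Q s t} : Derivable (tm (univ .prop :: Γ) φ (univ .prop)) →
      Derivable (tm (φ.rename (· + 2) :: arrow (.var 1) (.var 0) :: univ .prop :: univ .prop :: Γ) m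
        (φ.subst (scons (.var 2) fun k => .var (k + 4)))) →
      Derivable (tm Γ Q (univ .prop)) → Derivable (tm Γ s (arrow Q (φ.inst Q))) →
      Derivable (tm Γ t Q) → Derivable (tm Γ (nuCoind s t) (nu φ))

end DEKL

namespace DEKL

/-! ## A graph model of the untyped lambda calculus with constructors -/

/-! The calculus has a model in which falsum has no elements, so soundness (`Derivable.valid`)
leaves no closed term of type `bot`.

The elements of the model are sets of tokens, as in the graph models of the untyped lambda calculus.
A function is coded by its values at finite arguments, a Scott continuous function is recovered from
its code (`app_lam`), and self-application solves the recursion equations of all eliminators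
(`fix_eq`). Every raw term, typed or not, denotes a continuous function of each variable
(`cont_interp`). Definitional equality is sound as plain equality of denotations in all
environments, so conversion can be treated without typing, normalisation or confluence.

Types are themselves elements, read as codes. `IsCode` relates a code to its set of elements; it is
an inductive relation in place of an inductive-recursive definition, and `Code.unique` shows that it
is functional. The universes arise by well-founded recursion: the codes in `El U` mention only
universes of smaller rank. `Prop` is placed above every `Uc_i`, because it is closed under products
over computational types, and below every `Type_i`, to which it belongs.

A proposition has either no element or every element. Hence only inhabitation matters, a true
proposition is proved by any element, and `Prop` behaves like the two truth values. There a monotone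
operator has least fixed point φ(⊥) and greatest fixed point φ(⊤), which is how `mu` and `nu` are
interpreted.

No rule eliminates states, events, transitions, extensions, knowledge or infinite traces into an
arbitrary family. All of these may denote the type that contains every element, and the presheaves
play no role. Finite traces do have an eliminator and therefore get an inductive predicate,
`IsTrace`. Since the constants of the signature denote the empty set, the tokens do not depend on
the signature. -/

/-- Labels of the constructors of the model. -/
inductive Label : Type
  | univ (U : Univ)
  | pi
  | sigma
  | sum
  | bot
  | unit
  | nat
  | id
  | finTrace
  | trivial
  | pair
  | inl
  | inr
  | zero
  | suc
  | refl
  | star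
  | nil
  | step

/-- The tokens of the model: entries of the graph of a function, labels of constructors, and
tokens of the two arguments of a constructor. -/
inductive Token : Type
  | fn (l : List Token) (b : Token)
  | tag (c : Label)
  | left (b : Token)
  | right (b : Token)

/-- The elements of the model are the sets of tokens. -/
abbrev Dom : Type := Set Token

namespace Dom

/-! ### Finite elements and Scott continuity. -/

/-- The finite element with the tokens of a list. -/
def ofList (l : List Token) : Dom := {a | a ∈ l}

/-- Scott continuity. -/
def Cont (f : Dom → Dom) : Prop :=
  ∀ X b, b ∈ f X ↔ ∃ l, ofList l ⊆ X ∧ b ∈ f (ofList l)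

/-- Scott continuity of a function of two arguments. -/
def Cont₂ (h : Dom → Dom → Dom) : Prop :=
  ∀ X Y b, b ∈ h X Y ↔ ∃ l k, ofList l ⊆ X ∧ ofList k ⊆ Y ∧ b ∈ h (ofList l) (ofList k)

theorem ofList_subset {l : List Token} {X : Dom} : ofList l ⊆ X ↔ ∀ a ∈ l, a ∈ X := Iff.rfl

theorem ofList_append_subset {l k : List Token} {X : Dom} :
    ofList (l ++ k) ⊆ X ↔ ofList l ⊆ X ∧ ofList k ⊆ X := by
  simp [ofList_subset, or_imp, forall_and]

theorem ofList_subset_append_left (l k : List Token) : ofList l ⊆ ofList (l ++ k) :=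
  (ofList_append_subset.1 subset_rfl).1

theorem ofList_subset_append_right (l k : List Token) : ofList k ⊆ ofList (l ++ k) :=
  (ofList_append_subset.1 subset_rfl).2

theorem Cont.mono {f : Dom → Dom} (hf : Cont f) {X Y : Dom} (h : X ⊆ Y) : f X ⊆ f Y := by
  intro b hb
  obtain ⟨l, hl, hb⟩ := (hf X b).1 hb
  exact (hf Y b).2 ⟨l, hl.trans h, hb⟩

theorem Cont₂.mono {f : Dom → Dom → Dom} (hf : Cont₂ f) {X Y X' Y' : Dom} (h : X ⊆ X')
    (h' : Y ⊆ Y') : f X Y ⊆ f X' Y' := by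
  intro b hb
  obtain ⟨l, k, hl, hk, hb⟩ := (hf X Y b).1 hb
  exact (hf X' Y' b).2 ⟨l, k, hl.trans h, hk.trans h', hb⟩

/-- Each of the finitely many tokens of `l` depends on a finite part of `X`; by monotonicity the
concatenation of these parts serves all of them at once. -/
theorem Cont.exists_ofList {f : Dom → Dom} (hf : Cont f) {X : Dom} {l : List Token}
    (hl : ofList l ⊆ f X) : ∃ k, ofList k ⊆ X ∧ ofList l ⊆ f (ofList k) := by
  induction l with
  | nil => exact ⟨[], by simp [ofList_subset], by simp [ofList_subset]⟩
  | cons a l ih =>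
    simp only [ofList_subset, List.forall_mem_cons] at hl
    obtain ⟨k, hk, hlk⟩ := ih hl.2
    obtain ⟨k', hk', hak⟩ := (hf X a).1 hl.1
    refine ⟨k ++ k', ofList_append_subset.2 ⟨hk, hk'⟩, ?_⟩
    rw [ofList_subset, List.forall_mem_cons]
    exact ⟨hf.mono (ofList_subset_append_right _ _) hak,
      fun b hb => hf.mono (ofList_subset_append_left _ _) (hlk hb)⟩

theorem Cont₂.comp {h : Dom → Dom → Dom} (hh : Cont₂ h) {f g : Dom → Dom} (hf : Cont f)
    (hg : Cont g) : Cont fun x => h (f x) (g x) := by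
  intro X b
  constructor
  · intro hb
    obtain ⟨l, k, hl, hk, hb⟩ := (hh _ _ b).1 hb
    obtain ⟨l', hl', hll⟩ := hf.exists_ofList hl
    obtain ⟨k', hk', hkk⟩ := hg.exists_ofList hk
    exact ⟨l' ++ k', ofList_append_subset.2 ⟨hl', hk'⟩,
      hh.mono (hll.trans (hf.mono (ofList_subset_append_left _ _)))
        (hkk.trans (hg.mono (ofList_subset_append_right _ _))) hb⟩
  · rintro ⟨l, hl, hb⟩
    exact hh.mono (hf.mono hl) (hg.mono hl) hb

theorem cont_const (Y : Dom) : Cont fun _ => Y := by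
  intro X b
  exact ⟨fun hb => ⟨[], by simp [ofList_subset], hb⟩, fun ⟨_, _, hb⟩ => hb⟩

theorem cont_id : Cont fun X => X := by
  intro X b
  exact ⟨fun hb => ⟨[b], by simpa [ofList_subset] using hb, by simp [ofList]⟩,
    fun ⟨_, hl, hb⟩ => hl hb⟩

/-! ### Application, abstraction and constructors, with their continuity. -/

/-- The application of the graph of a function. -/
def app (f a : Dom) : Dom := {b | ∃ l, ofList l ⊆ a ∧ Token.fn l b ∈ f}

/-- The graph of a function. -/
def lam (f : Dom → Dom) : Dom := {t | ∃ l b, t = Token.fn l b ∧ b ∈ f (ofList l)}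

/-- The constructor with label `c`. -/
def con (c : Label) (a b : Dom) : Dom :=
  {t | t = Token.tag c ∨ (∃ s ∈ a, t = Token.left s) ∨ ∃ s ∈ b, t = Token.right s}

/-- The first argument of a constructor. -/
def fst (d : Dom) : Dom := {t | Token.left t ∈ d}

/-- The second argument of a constructor. -/
def snd (d : Dom) : Dom := {t | Token.right t ∈ d}

/-- `e` if `d` is made with the constructor labelled `c`, and the least element otherwise. -/
def guard (c : Label) (d e : Dom) : Dom := {t | Token.tag c ∈ d ∧ t ∈ e}

theorem cont₂_app : Cont₂ app := by
  intro X Y b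
  constructor
  · rintro ⟨l, hl, hb⟩
    -- One graph entry of the function and the finite argument recorded in it are all that an output
    -- token uses.
    exact ⟨[Token.fn l b], l, by simpa [ofList_subset] using hb, hl, l, subset_rfl, by
      simp [ofList]⟩
  · rintro ⟨k, l, hk, hl, l', hl', hb⟩
    exact ⟨l', hl'.trans hl, hk hb⟩

theorem cont₂_con (c : Label) : Cont₂ (con c) := by
  intro X Y b
  constructor
  · rintro (rfl | ⟨s, hs, rfl⟩ | ⟨s, hs, rfl⟩)
    · exact ⟨[], [], by simp [ofList_subset], by simp [ofList_subset], .inl rfl⟩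
    · exact ⟨[s], [], by simpa [ofList_subset], by simp [ofList_subset],
        .inr (.inl ⟨s, by simp [ofList], rfl⟩)⟩
    · exact ⟨[], [s], by simp [ofList_subset], by simpa [ofList_subset],
        .inr (.inr ⟨s, by simp [ofList], rfl⟩)⟩
  · rintro ⟨l, k, hl, hk, (rfl | ⟨s, hs, rfl⟩ | ⟨s, hs, rfl⟩)⟩
    · exact .inl rfl
    · exact .inr (.inl ⟨s, hl hs, rfl⟩)
    · exact .inr (.inr ⟨s, hk hs, rfl⟩)

theorem cont₂_guard (c : Label) : Cont₂ (guard c) := by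
  intro X Y b
  constructor
  · rintro ⟨h, hb⟩
    exact ⟨[Token.tag c], [b], by simpa [ofList_subset], by simpa [ofList_subset],
      by simp [ofList], by simp [ofList]⟩
  · rintro ⟨l, k, hl, hk, h, hb⟩
    exact ⟨hl h, hk hb⟩

theorem cont₂_union : Cont₂ (· ∪ ·) := by
  intro X Y b
  constructor
  · rintro (h | h)
    · exact ⟨[b], [], by simpa [ofList_subset], by simp [ofList_subset], .inl (by simp [ofList])⟩
    · exact ⟨[], [b], by simp [ofList_subset], by simpa [ofList_subset], .inr (by simp [ofList])⟩
  · rintro ⟨l, k, hl, hk, h | h⟩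
    · exact .inl (hl h)
    · exact .inr (hk h)

theorem Cont.app {f g : Dom → Dom} (hf : Cont f) (hg : Cont g) :
    Cont fun x => (f x).app (g x) := cont₂_app.comp hf hg

theorem Cont.con {f g : Dom → Dom} (c : Label) (hf : Cont f) (hg : Cont g) :
    Cont fun x => con c (f x) (g x) := (cont₂_con c).comp hf hg

theorem Cont.guard {f g : Dom → Dom} (c : Label) (hf : Cont f) (hg : Cont g) :
    Cont fun x => guard c (f x) (g x) := (cont₂_guard c).comp hf hg

theorem Cont.union {f g : Dom → Dom} (hf : Cont f) (hg : Cont g) :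
    Cont fun x => f x ∪ g x := cont₂_union.comp hf hg

theorem Cont.fst {f : Dom → Dom} (hf : Cont f) : Cont fun x => (f x).fst :=
  fun X b => hf X (Token.left b)

theorem Cont.snd {f : Dom → Dom} (hf : Cont f) : Cont fun x => (f x).snd :=
  fun X b => hf X (Token.right b)

theorem Cont.lam {f : Dom → Dom → Dom} (hf : ∀ y, Cont fun x => f x y) :
    Cont fun x => lam (f x) := by
  intro X t
  constructor
  · rintro ⟨l, b, rfl, hb⟩
    obtain ⟨k, hk, hb⟩ := (hf (ofList l) X b).1 hb
    exact ⟨k, hk, l, b, rfl, hb⟩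
  · rintro ⟨k, hk, l, b, rfl, hb⟩
    exact ⟨l, b, rfl, (hf (ofList l) X b).2 ⟨k, hk, hb⟩⟩

/-- This is the β-rule. The graph records values at finite arguments only, and continuity says that
these determine the value at `a`. The η-rule fails, since an element may contain tokens that are not
graph entries, but the calculus does not have it. -/
theorem app_lam {f : Dom → Dom} (hf : Cont f) (a : Dom) : (lam f).app a = f a := by
  ext b
  rw [hf a b]
  constructor
  · rintro ⟨l, hl, l', b', h, hb⟩
    cases h
    exact ⟨l, hl, hb⟩
  · rintro ⟨l, hl, hb⟩
    exact ⟨l, hl, l, b, rfl, hb⟩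

@[simp] theorem fst_con (c : Label) (a b : Dom) : (con c a b).fst = a := by
  ext t; simp [fst, con]

@[simp] theorem snd_con (c : Label) (a b : Dom) : (con c a b).snd = b := by
  ext t; simp [snd, con]

@[simp] theorem tag_mem_con {c c' : Label} {a b : Dom} : Token.tag c ∈ con c' a b ↔ c = c' := by
  simp [con]

@[simp] theorem con_inj {c c' : Label} {a b a' b' : Dom} :
    con c a b = con c' a' b' ↔ c = c' ∧ a = a' ∧ b = b' := by
  constructor
  · intro h
    refine ⟨?_, ?_, ?_⟩
    · rw [← tag_mem_con (a := a') (b := b'), ← h, tag_mem_con]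
    · rw [← fst_con c a b, h, fst_con]
    · rw [← snd_con c a b, h, snd_con]
  · rintro ⟨rfl, rfl, rfl⟩
    rfl

@[simp] theorem guard_con_self (c : Label) (a b e : Dom) : guard c (con c a b) e = e := by
  ext t; simp [guard]

theorem guard_con_of_ne {c c' : Label} (h : c ≠ c') (a b e : Dom) :
    guard c (con c' a b) e = ∅ := by
  ext t; simp [guard, h]

theorem Cont.comp {f g : Dom → Dom} (hf : Cont f) (hg : Cont g) : Cont fun x => f (g x) :=
  Cont₂.comp (h := fun _ y => f y)
    (fun X Y b => by
      rw [hf Y b]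
      exact ⟨fun ⟨l, hl, hb⟩ => ⟨[], l, by simp [ofList_subset], hl, hb⟩,
        fun ⟨_, l, _, hl, hb⟩ => ⟨l, hl, hb⟩⟩)
    cont_id hg

/-! ### Fixed points and the recursors of the calculus. -/

/-- A fixed point of a continuous function, obtained by self-application. -/
def fix (F : Dom → Dom) : Dom := app (lam fun w => F (app w w)) (lam fun w => F (app w w))

/-- This is the β-rule for Curry's fixed-point combinator. Only the equation is used below, never
leastness. -/
theorem fix_eq {F : Dom → Dom} (hF : Cont F) : fix F = F (fix F) :=
  app_lam (hF.comp (cont_id.app cont_id)) _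

theorem Cont.fix {F : Dom → Dom → Dom} (hF : ∀ g, Cont fun x => F x g) :
    Cont fun x => fix (F x) :=
  have h : Cont fun x => Dom.lam fun w => F x (Dom.app w w) := .lam fun w => hF (Dom.app w w)
  .app h h

/-- Case distinction on a binary sum. -/
def case (f g t : Dom) : Dom := guard .inl t (app f t.fst) ∪ guard .inr t (app g t.fst)

@[simp] theorem case_inl (f g a b : Dom) : case f g (con .inl a b) = app f a := by
  simp [case, guard_con_of_ne]

@[simp] theorem case_inr (f g a b : Dom) : case f g (con .inr a b) = app g a := by
  simp [case, guard_con_of_ne]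

theorem Cont.case {f g t : Dom → Dom} (hf : Cont f) (hg : Cont g) (ht : Cont t) :
    Cont fun x => case (f x) (g x) (t x) :=
  .union (.guard _ ht (.app hf ht.fst)) (.guard _ ht (.app hg ht.fst))

/-- The recursion equation of `natRec`. -/
def natRecBody (z s g : Dom) : Dom :=
  lam fun n => guard .zero n z ∪ guard .suc n (app (app s n.fst) (app g n.fst))

/-- Recursion on natural numbers. -/
def natRec (z s n : Dom) : Dom := app (fix (natRecBody z s)) n

/-- Both guards test for the presence of a tag, a monotone condition, so the case distinction is
continuous. On a numeral one of the two guarded sets is empty and the union is the wanted branch. -/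
theorem natRec_eq (z s n : Dom) :
    natRec z s n = guard .zero n z ∪ guard .suc n (app (app s n.fst) (natRec z s n.fst)) := by
  have h : Cont (natRecBody z s) := .lam fun n =>
    .union (cont_const _) (.guard _ (cont_const _) (.app (cont_const _) (cont_id.app (cont_const _))))
  rw [natRec, fix_eq h, natRecBody, app_lam]
  · rfl
  · exact .union (.guard _ cont_id (cont_const _)) (.guard _ cont_id
      (.app (.app (cont_const _) cont_id.fst) (.app (cont_const _) cont_id.fst)))

@[simp] theorem natRec_zero (z s a b : Dom) : natRec z s (con .zero a b) = z := by
  rw [natRec_eq]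
  simp [guard_con_of_ne]

@[simp] theorem natRec_suc (z s a b : Dom) :
    natRec z s (con .suc a b) = app (app s a) (natRec z s a) := by
  rw [natRec_eq]
  simp [guard_con_of_ne]

theorem Cont.natRec {z s n : Dom → Dom} (hz : Cont z) (hs : Cont s) (hn : Cont n) :
    Cont fun x => natRec (z x) (s x) (n x) :=
  .app (.fix fun _ => .lam fun _ => .union (.guard _ (cont_const _) hz)
    (.guard _ (cont_const _) (.app (.app hs (cont_const _)) (cont_const _)))) hn

/-- The nonempty trace that extends `τ` by a step. -/
def step (σ₁ σ₂ τ e π : Dom) : Dom :=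
  con .step τ (con .pair (con .pair σ₁ σ₂) (con .pair e π))

/-- The recursion equation of `traceElim`. -/
def traceElimBody (b s g : Dom) : Dom :=
  lam fun τ => guard .nil τ b ∪ guard .step τ
    (app (app (app (app (app (app s τ.snd.fst.fst) τ.fst) τ.snd.snd.fst) τ.snd.fst.snd)
      τ.snd.snd.snd) (app g τ.fst))

/-- Recursion on finite traces. -/
def traceElim (b s τ : Dom) : Dom := app (fix (traceElimBody b s)) τ

theorem traceElim_eq (b s τ : Dom) :
    traceElim b s τ = guard .nil τ b ∪ guard .step τ
      (app (app (app (app (app (app s τ.snd.fst.fst) τ.fst) τ.snd.snd.fst) τ.snd.fst.snd)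
        τ.snd.snd.snd) (traceElim b s τ.fst)) := by
  have h : Cont (traceElimBody b s) := .lam fun τ =>
    .union (cont_const _) (.guard _ (cont_const _) (.app (cont_const _) (cont_id.app (cont_const _))))
  rw [traceElim, fix_eq h, traceElimBody, app_lam]
  · rfl
  · have h := cont_id
    exact .union (.guard _ h (cont_const _)) (.guard _ h
      (.app (.app (.app (.app (.app (.app (cont_const _) h.snd.fst.fst) h.fst) h.snd.snd.fst)
        h.snd.fst.snd) h.snd.snd.snd) (.app (cont_const _) h.fst)))

@[simp] theorem traceElim_nil (b s a a' : Dom) : traceElim b s (con .nil a a') = b := by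
  rw [traceElim_eq]
  simp [guard_con_of_ne]

@[simp] theorem traceElim_step (b s σ₁ σ₂ τ e π : Dom) :
    traceElim b s (step σ₁ σ₂ τ e π) =
      app (app (app (app (app (app s σ₁) τ) e) σ₂) π) (traceElim b s τ) := by
  rw [traceElim_eq]
  simp [step, guard_con_of_ne]

theorem Cont.step {σ₁ σ₂ τ e π : Dom → Dom} (h₁ : Cont σ₁) (h₂ : Cont σ₂) (hτ : Cont τ)
    (he : Cont e) (hπ : Cont π) : Cont fun x => step (σ₁ x) (σ₂ x) (τ x) (e x) (π x) :=
  .con _ hτ (.con _ (.con _ h₁ h₂) (.con _ he hπ))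

theorem Cont.traceElim {b s τ : Dom → Dom} (hb : Cont b) (hs : Cont s) (hτ : Cont τ) :
    Cont fun x => traceElim (b x) (s x) (τ x) :=
  .app (.fix fun _ => .lam fun _ => .union (.guard _ (cont_const _) hb)
    (.guard _ (cont_const _) (.app (.app (.app (.app (.app (.app hs (cont_const _)) (cont_const _))
      (cont_const _)) (cont_const _)) (cont_const _)) (cont_const _)))) hτ

/-- The recursion equation of `corec`. -/
def corecBody (h n g : Dom) : Dom :=
  lam fun a => con .pair (app h a) (con .pair (app n a).fst (app g (app n a).snd))

/-- Corecursion for infinite traces, which are pairs of a head and a tail. -/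
def corec (h n a : Dom) : Dom := app (fix (corecBody h n)) a

/-- One unfolding already exhibits head and tail, so both computation rules of corecursion follow
from it by projection. -/
theorem corec_eq (h n a : Dom) :
    corec h n a = con .pair (app h a) (con .pair (app n a).fst (corec h n (app n a).snd)) := by
  have hc : Cont (corecBody h n) := .lam fun a =>
    .con _ (cont_const _) (.con _ (cont_const _) (.app cont_id (cont_const _)))
  rw [corec, fix_eq hc, corecBody, app_lam]
  · rfl
  · have ha : Cont (app n) := .app (cont_const _) cont_id
    exact .con _ (.app (cont_const _) cont_id) (.con _ ha.fst (.app (cont_const _) ha.snd))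

theorem Cont.corec {h n a : Dom → Dom} (hh : Cont h) (hn : Cont n) (ha : Cont a) :
    Cont fun x => corec (h x) (n x) (a x) :=
  have hn' (b : Dom) : Cont fun x => Dom.app (n x) b := .app hn (cont_const _)
  .app (.fix fun _ => .lam fun b => .con _ (.app hh (cont_const _))
    (.con _ (hn' b).fst (.app (cont_const _) (hn' b).snd))) ha

end Dom

/-! ## Interpretation of terms -/

open Dom

/-- Extension of an environment. -/
def Env.cons (a : Dom) (ρ : ℕ → Dom) : ℕ → Dom
  | 0 => a
  | n + 1 => ρ n

/-- The code of a type that contains every element of the model. -/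
def trivialCode : Dom := con .trivial ∅ ∅

/-- The code of the empty type. -/
def botCode : Dom := con .bot ∅ ∅

namespace Tm

variable {S : Signature.{u}}

/-- The interpretation of raw terms in the model. The types of states, events, transitions,
extensions, knowledge and infinite traces are interpreted by a type that contains every element,
the proof terms for fixed points by the least element, and a fixed point of a proposition operator by its
value at the false, resp. the true proposition. -/
def interp : Tm S → (ℕ → Dom) → Dom
  | var n, ρ => ρ n
  | univ U, _ => con (.univ U) ∅ ∅
  | pi A B, ρ => con .pi (A.interp ρ) (Dom.lam fun x => B.interp (Env.cons x ρ))
  | lam t, ρ => Dom.lam fun x => t.interp (Env.cons x ρ)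
  | app f a, ρ => (f.interp ρ).app (a.interp ρ)
  | sigma A B, ρ => con .sigma (A.interp ρ) (Dom.lam fun x => B.interp (Env.cons x ρ))
  | pair a b, ρ => con .pair (a.interp ρ) (b.interp ρ)
  | fst t, ρ => (t.interp ρ).fst
  | snd t, ρ => (t.interp ρ).snd
  | bot, _ => botCode
  | abort _, _ => ∅
  | unit, _ => con .unit ∅ ∅
  | star, _ => con .star ∅ ∅
  | unitRec c _, ρ => c.interp ρ
  | sum A B, ρ => con .sum (A.interp ρ) (B.interp ρ)
  | inl a, ρ => con .inl (a.interp ρ) ∅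
  | inr b, ρ => con .inr (b.interp ρ) ∅
  | case f g t, ρ => Dom.case (f.interp ρ) (g.interp ρ) (t.interp ρ)
  | nat, _ => con .nat ∅ ∅
  | zero, _ => con .zero ∅ ∅
  | suc n, ρ => con .suc (n.interp ρ) ∅
  | natRec z s n, ρ => Dom.natRec (z.interp ρ) (s.interp ρ) (n.interp ρ)
  | id _ a b, ρ => con .id (a.interp ρ) (b.interp ρ)
  | refl, _ => con .refl ∅ ∅
  | idRec d _, ρ => d.interp ρ
  | state, _ => trivialCode
  | event, _ => trivialCode
  | stepTy _ _ _, _ => trivialCode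
  | stateC _, _ => ∅
  | eventC _, _ => ∅
  | stepC _, _ => ∅
  | finTrace σ σ', ρ => con .finTrace (σ.interp ρ) (σ'.interp ρ)
  | nil σ, ρ => con .nil (σ.interp ρ) ∅
  | step σ₁ σ₂ τ e π, ρ =>
      Dom.step (σ₁.interp ρ) (σ₂.interp ρ) (τ.interp ρ) (e.interp ρ) (π.interp ρ)
  | traceElim b s τ, ρ => Dom.traceElim (b.interp ρ) (s.interp ρ) (τ.interp ρ)
  | infTrace, _ => trivialCode
  | head t, ρ => (t.interp ρ).fst
  | tail t, ρ => (t.interp ρ).snd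
  | corec h n a, ρ => Dom.corec (h.interp ρ) (n.interp ρ) (a.interp ρ)
  | ext _ _, _ => trivialCode
  | extId, _ => ∅
  | extStep _ _, _ => ∅
  | extComp ε₁ ε₂, ρ => ε₁.interp ρ ∪ ε₂.interp ρ
  | know _ _, _ => trivialCode
  | knowC _ _ _, _ => ∅
  | restrict _ k, ρ => k.interp ρ
  | mu φ, ρ => φ.interp (Env.cons botCode ρ)
  | muIn _, _ => ∅
  | muInd _ _, _ => ∅
  | nu φ, ρ => φ.interp (Env.cons trivialCode ρ)
  | nuOut _, _ => ∅
  | nuCoind _ _, _ => ∅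

/-- Without continuity the denotation of `lam` would not satisfy β. The environment varies in all
its entries at once, so that the induction passes under binders. -/
theorem cont_interp (t : Tm S) {e : Dom → ℕ → Dom} (he : ∀ n, Cont fun x => e x n) :
    Cont fun x => t.interp (e x) := by
  have hcons {e : Dom → ℕ → Dom} (he : ∀ n, Cont fun x => e x n) (y : Dom) (n : ℕ) :
      Cont fun x => Env.cons y (e x) n := by
    cases n with
    | zero => exact cont_const _
    | succ n => exact he n
  induction t generalizing e with
  | var n => exact he n
  | pi A B ihA ihB | sigma A B ihA ihB =>
    exact .con _ (ihA he) (.lam fun y => ihB (hcons he y))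
  | lam t ih => exact .lam fun y => ih (hcons he y)
  | app f a ihf iha => exact .app (ihf he) (iha he)
  | pair a b iha ihb | sum a b iha ihb | finTrace a b iha ihb => exact .con _ (iha he) (ihb he)
  | id A a b _ iha ihb => exact .con _ (iha he) (ihb he)
  | fst t ih | head t ih => exact (ih he).fst
  | snd t ih | tail t ih => exact (ih he).snd
  | unitRec c t ih _ | idRec c t ih _ => exact ih he
  | restrict t c _ ih => exact ih he
  | inl a ih | inr a ih | suc a ih | nil a ih => exact .con _ (ih he) (cont_const _)
  | case f g t ihf ihg iht => exact .case (ihf he) (ihg he) (iht he)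
  | natRec f g t ihf ihg iht => exact .natRec (ihf he) (ihg he) (iht he)
  | traceElim f g t ihf ihg iht => exact .traceElim (ihf he) (ihg he) (iht he)
  | corec f g t ihf ihg iht => exact .corec (ihf he) (ihg he) (iht he)
  | step _ _ _ _ _ ih₁ ih₂ ih₃ ih₄ ih₅ =>
    exact .step (ih₁ he) (ih₂ he) (ih₃ he) (ih₄ he) (ih₅ he)
  | extComp a b iha ihb => exact .union (iha he) (ihb he)
  | mu φ ih | nu φ ih => exact ih (hcons he _)
  | _ => exact cont_const _

theorem cont_interp_cons (t : Tm S) (ρ : ℕ → Dom) : Cont fun x => t.interp (Env.cons x ρ) :=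
  t.cont_interp fun n => by
    cases n with
    | zero => exact cont_id
    | succ n => exact cont_const _

theorem interp_rename (t : Tm S) (r : ℕ → ℕ) (ρ : ℕ → Dom) :
    (t.rename r).interp ρ = t.interp fun n => ρ (r n) := by
  have hcons (x : Dom) (ρ : ℕ → Dom) (r : ℕ → ℕ) :
      (fun n => Env.cons x ρ (upRen r n)) = Env.cons x fun n => ρ (r n) := by
    funext n; cases n <;> rfl
  induction t generalizing r ρ <;> simp only [rename, interp, *]

@[simp] theorem interp_shift (t : Tm S) (k : ℕ) (ρ : ℕ → Dom) :
    (t.shift k).interp ρ = t.interp fun n => ρ (n + k) :=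
  t.interp_rename _ _

/-- Substitution is a change of environment up to equality of elements, which makes instances of
types and the substitution rule for equality immediate. -/
theorem interp_subst (t : Tm S) (θ : ℕ → Tm S) (ρ : ℕ → Dom) :
    (t.subst θ).interp ρ = t.interp fun n => (θ n).interp ρ := by
  have hcons (x : Dom) (ρ : ℕ → Dom) (θ : ℕ → Tm S) :
      (fun n => (up θ n).interp (Env.cons x ρ)) = Env.cons x fun n => (θ n).interp ρ := by
    funext n
    cases n with
    | zero => rfl
    | succ n => exact interp_shift _ _ _
  induction t generalizing θ ρ <;> simp only [subst, interp, *]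

theorem interp_subst_scons (t a : Tm S) (θ : ℕ → Tm S) (ρ : ℕ → Dom) :
    (t.subst (scons a θ)).interp ρ =
      t.interp (Env.cons (a.interp ρ) fun n => (θ n).interp ρ) := by
  rw [interp_subst]
  congr 1
  funext n
  cases n <;> rfl

theorem interp_subst_scons₂ (t a b : Tm S) (θ : ℕ → Tm S) (ρ : ℕ → Dom) :
    (t.subst (scons b (scons a θ))).interp ρ =
      t.interp (Env.cons (b.interp ρ) (Env.cons (a.interp ρ) fun n => (θ n).interp ρ)) := by
  rw [interp_subst_scons]
  congr 2
  funext n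
  cases n <;> rfl

theorem interp_inst (t a : Tm S) (ρ : ℕ → Dom) :
    (t.inst a).interp ρ = t.interp (Env.cons (a.interp ρ) ρ) :=
  interp_subst_scons _ _ _ _

theorem interp_inst₂ (t a b : Tm S) (ρ : ℕ → Dom) :
    (t.inst₂ a b).interp ρ = t.interp (Env.cons (b.interp ρ) (Env.cons (a.interp ρ) ρ)) :=
  interp_subst_scons₂ _ _ _ _ _

end Tm

/-! ## Semantic types -/

/-- The natural numbers of the model. -/
inductive IsNat : Dom → Prop
  | zero : IsNat (con .zero ∅ ∅)
  | suc {n : Dom} : IsNat n → IsNat (con .suc n ∅)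

/-- `IsTrace σ₀ σ τ`: `τ` is a finite trace of the model from `σ₀` to `σ`. -/
inductive IsTrace (σ₀ : Dom) : Dom → Dom → Prop
  | nil : IsTrace σ₀ σ₀ (con .nil σ₀ ∅)
  | step {σ₁ σ₂ τ e π : Dom} : IsTrace σ₀ σ₁ τ → IsTrace σ₀ σ₂ (Dom.step σ₁ σ₂ τ e π)

/-- `IsCode below I A P`: `A` is a code of a type with set of elements `P`, made from the universes
that satisfy `below`, whose sets of elements are given by `I`. -/
inductive IsCode (below : Univ → Prop) (I : ∀ U, below U → Set Dom) : Dom → Set Dom → Prop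
  | univ (U : Univ) (hU : below U) : IsCode below I (con (.univ U) ∅ ∅) (I U hU)
  | pi {A F : Dom} {P : Set Dom} {Q : Dom → Set Dom} : IsCode below I A P →
      (∀ a ∈ P, IsCode below I (app F a) (Q a)) →
      IsCode below I (con .pi A F) {f | ∀ a ∈ P, app f a ∈ Q a}
  | sigma {A F : Dom} {P : Set Dom} {Q : Dom → Set Dom} : IsCode below I A P →
      (∀ a ∈ P, IsCode below I (app F a) (Q a)) →
      IsCode below I (con .sigma A F) {p | p.fst ∈ P ∧ p.snd ∈ Q p.fst}
  | sum {A B : Dom} {P Q : Set Dom} : IsCode below I A P → IsCode below I B Q →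
      IsCode below I (con .sum A B)
        {t | (∃ a ∈ P, t = con .inl a ∅) ∨ ∃ b ∈ Q, t = con .inr b ∅}
  | bot : IsCode below I botCode ∅
  | unit : IsCode below I (con .unit ∅ ∅) {con .star ∅ ∅}
  | nat : IsCode below I (con .nat ∅ ∅) {n | IsNat n}
  | id (a b : Dom) : IsCode below I (con .id a b) {p | a = b ∧ p = con .refl ∅ ∅}
  | finTrace (σ₀ σ : Dom) : IsCode below I (con .finTrace σ₀ σ) {τ | IsTrace σ₀ σ τ}
  | trivial : IsCode below I trivialCode Set.univ

/-- The order of the universes in the model: all `Uc_i`, then `Prop`, then all `Type_i`. -/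
def Univ.rank : Univ → ℕ ×ₗ ℕ
  | .uc i => toLex (0, i)
  | .prop => toLex (1, 0)
  | .ty i => toLex (2, i)

/-- A set of elements that does not distinguish proofs. -/
def IsProp (P : Set Dom) : Prop := ∀ a ∈ P, P = Set.univ

/-- The codes of the types in a universe. A proposition is a type with all or no elements. -/
def El (U : Univ) : Set Dom :=
  {A | ∃ P, IsCode (fun V => V.rank < U.rank) (fun V _ => El V) A P ∧ (U = .prop → IsProp P)}
termination_by U.rank
decreasing_by assumption

/-- `TypeCode below A P`: `A` is a code of a type with set of elements `P` that is made from the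
universes that satisfy `below`. -/
abbrev TypeCode (below : Univ → Prop) : Dom → Set Dom → Prop := IsCode below fun V _ => El V

theorem mem_El {U : Univ} {A : Dom} :
    A ∈ El U ↔ ∃ P, TypeCode (fun V => V.rank < U.rank) A P ∧ (U = .prop → IsProp P) := by
  rw [El]; rfl

/-- The elements of a universe code `U` are `El U` whatever `below` is, so enlarging `below` keeps
the set of elements. This yields cumulativity, and it lets all codes be compared inside `Code`. -/
theorem TypeCode.mono {b b' : Univ → Prop} (h : ∀ U, b U → b' U) {A : Dom} {P : Set Dom}
    (hA : TypeCode b A P) : TypeCode b' A P := by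
  induction hA with
  | univ U hU => exact .univ U (h U hU)
  | pi _ _ ihA ihB => exact .pi ihA ihB
  | sigma _ _ ihA ihB => exact .sigma ihA ihB
  | sum _ _ ihA ihB => exact .sum ihA ihB
  | bot => exact .bot
  | unit => exact .unit
  | nat => exact .nat
  | id a b => exact .id a b
  | finTrace a b => exact .finTrace a b
  | trivial => exact .trivial

/-- The codes of all types. -/
abbrev Code : Dom → Set Dom → Prop := TypeCode fun _ => True

theorem TypeCode.code {b : Univ → Prop} {A : Dom} {P : Set Dom} (hA : TypeCode b A P) : Code A P :=
  hA.mono fun _ _ => True.intro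

/-! ### Inversion of codes and uniqueness of their sets of elements. -/

theorem code_univ {U : Univ} {P : Set Dom} (h : Code (con (.univ U) ∅ ∅) P) : P = El U := by
  -- `con` is a function on sets and not a free constructor, so the code becomes a variable before
  -- the case analysis; the other cases are refuted by injectivity of `con` and distinctness of
  -- labels.
  generalize hX : con (.univ U) ∅ ∅ = X at h
  cases h <;> simp_all [botCode, trivialCode]

theorem code_pi {A F : Dom} {P : Set Dom} (h : Code (con .pi A F) P) :
    ∃ (PA : Set Dom) (Q : Dom → Set Dom), Code A PA ∧ (∀ a ∈ PA, Code (app F a) (Q a)) ∧ P = {f | ∀ a ∈ PA, app f a ∈ Q a} := by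
  generalize hX : con .pi A F = X at h
  cases h <;> simp [botCode, trivialCode] at hX
  obtain ⟨rfl, rfl⟩ := hX
  exact ⟨_, _, ‹_›, ‹_›, rfl⟩

theorem code_sigma {A F : Dom} {P : Set Dom} (h : Code (con .sigma A F) P) :
    ∃ (PA : Set Dom) (Q : Dom → Set Dom), Code A PA ∧ (∀ a ∈ PA, Code (app F a) (Q a)) ∧
      P = {p | p.fst ∈ PA ∧ p.snd ∈ Q p.fst} := by
  generalize hX : con .sigma A F = X at h
  cases h <;> simp [botCode, trivialCode] at hX
  obtain ⟨rfl, rfl⟩ := hX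
  exact ⟨_, _, ‹_›, ‹_›, rfl⟩

theorem code_sum {A B : Dom} {P : Set Dom} (h : Code (con .sum A B) P) :
    ∃ PA PB, Code A PA ∧ Code B PB ∧
      P = {t | (∃ a ∈ PA, t = con .inl a ∅) ∨ ∃ b ∈ PB, t = con .inr b ∅} := by
  generalize hX : con .sum A B = X at h
  cases h <;> simp [botCode, trivialCode] at hX
  obtain ⟨rfl, rfl⟩ := hX
  exact ⟨_, _, ‹_›, ‹_›, rfl⟩

theorem code_bot {P : Set Dom} (h : Code botCode P) : P = ∅ := by
  generalize hX : botCode = X at h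
  cases h <;> simp_all [botCode, trivialCode]

theorem code_unit {P : Set Dom} (h : Code (con .unit ∅ ∅) P) : P = {con .star ∅ ∅} := by
  generalize hX : con .unit ∅ ∅ = X at h
  cases h <;> simp_all [botCode, trivialCode]

theorem code_nat {P : Set Dom} (h : Code (con .nat ∅ ∅) P) : P = {n | IsNat n} := by
  generalize hX : con .nat ∅ ∅ = X at h
  cases h <;> simp_all [botCode, trivialCode]

theorem code_id {a b : Dom} {P : Set Dom} (h : Code (con .id a b) P) :
    P = {p | a = b ∧ p = con .refl ∅ ∅} := by
  generalize hX : con .id a b = X at h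
  cases h <;> simp_all [botCode, trivialCode]

theorem code_finTrace {σ₀ σ : Dom} {P : Set Dom} (h : Code (con .finTrace σ₀ σ) P) :
    P = {τ | IsTrace σ₀ σ τ} := by
  generalize hX : con .finTrace σ₀ σ = X at h
  cases h <;> simp_all [botCode, trivialCode]

theorem code_trivial {P : Set Dom} (h : Code trivialCode P) : P = Set.univ := by
  generalize hX : trivialCode = X at h
  cases h <;> simp_all [botCode, trivialCode]

/-- The set of elements of a type is determined by its code. -/
theorem Code.unique {A : Dom} {P P' : Set Dom} (h : Code A P) (h' : Code A P') : P = P' := by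
  induction h generalizing P' with
  | univ U _ => exact (code_univ h').symm
  | pi _ _ ihA ihB =>
    obtain ⟨PA, Q, hA, hB, rfl⟩ := code_pi h'
    obtain rfl := ihA hA
    ext f
    exact forall₂_congr fun a ha => by rw [ihB a ha (hB a ha)]
  | sigma _ _ ihA ihB =>
    obtain ⟨PA, Q, hA, hB, rfl⟩ := code_sigma h'
    obtain rfl := ihA hA
    ext p
    exact and_congr_right fun ha => by rw [ihB _ ha (hB _ ha)]
  | sum _ _ ihA ihB =>
    obtain ⟨PA, PB, hA, hB, rfl⟩ := code_sum h'
    obtain rfl := ihA hA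
    obtain rfl := ihB hB
    rfl
  | bot => exact (code_bot h').symm
  | unit => exact (code_unit h').symm
  | nat => exact (code_nat h').symm
  | id => exact (code_id h').symm
  | finTrace => exact (code_finTrace h').symm
  | trivial => exact (code_trivial h').symm

/-! ### Membership in a type, for each type former. -/

/-- `A` is the code of a type. -/
def IsType (A : Dom) : Prop := ∃ P, Code A P

/-- `A` is the code of a type that contains `a`. -/
def Mem (a A : Dom) : Prop := ∃ P, Code A P ∧ a ∈ P

theorem Mem.isType {a A : Dom} (h : Mem a A) : IsType A := h.imp fun _ h => h.1

theorem Code.mem_iff {A a : Dom} {P : Set Dom} (h : Code A P) : Mem a A ↔ a ∈ P :=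
  ⟨fun ⟨_, h', ha⟩ => h.unique h' ▸ ha, fun ha => ⟨P, h, ha⟩⟩

theorem mem_univ_iff {U : Univ} {A : Dom} : Mem A (con (.univ U) ∅ ∅) ↔ A ∈ El U :=
  Code.mem_iff (.univ U True.intro)

theorem mem_bot {a : Dom} : ¬ Mem a botCode := by
  simpa using Code.mem_iff (a := a) .bot

@[simp] theorem mem_trivial (a : Dom) : Mem a trivialCode :=
  (Code.mem_iff .trivial).2 True.intro

theorem mem_unit_iff {a : Dom} : Mem a (con .unit ∅ ∅) ↔ a = con .star ∅ ∅ :=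
  Code.mem_iff .unit

theorem mem_nat_iff {a : Dom} : Mem a (con .nat ∅ ∅) ↔ IsNat a :=
  Code.mem_iff .nat

theorem mem_id_iff {a b p : Dom} : Mem p (con .id a b) ↔ a = b ∧ p = con .refl ∅ ∅ :=
  Code.mem_iff (.id a b)

theorem mem_finTrace_iff {σ₀ σ τ : Dom} : Mem τ (con .finTrace σ₀ σ) ↔ IsTrace σ₀ σ τ :=
  Code.mem_iff (.finTrace σ₀ σ)

/-- The product and sum codes ask for one function `Q` giving the elements of all fibres; it is
obtained by choice, together with a side condition `p` such as being a proposition. -/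
theorem exists_family {b : Univ → Prop} {F : Dom → Dom} {P : Set Dom}
    {p : Dom → Set Dom → Prop} (h : ∀ a ∈ P, ∃ Q, TypeCode b (F a) Q ∧ p a Q) :
    ∃ Q : Dom → Set Dom, ∀ a ∈ P, TypeCode b (F a) (Q a) ∧ p a (Q a) := by
  choose! Q hQ using h
  exact ⟨Q, hQ⟩

theorem mem_pi_iff {A F f : Dom} : Mem f (con .pi A F) ↔
    IsType A ∧ (∀ a, Mem a A → IsType (app F a)) ∧ ∀ a, Mem a A → Mem (app f a) (app F a) := by
  constructor
  · rintro ⟨_, h, hf⟩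
    obtain ⟨P, Q, hA, hB, rfl⟩ := code_pi h
    exact ⟨⟨P, hA⟩, fun a ha => ⟨_, hB a (hA.mem_iff.1 ha)⟩,
      fun a ha => ⟨_, hB a (hA.mem_iff.1 ha), hf a (hA.mem_iff.1 ha)⟩⟩
  · rintro ⟨⟨P, hA⟩, -, hf⟩
    simp only [hA.mem_iff] at hf
    obtain ⟨Q, hQ⟩ := exists_family (p := fun a Q => app f a ∈ Q) hf
    exact ⟨_, .pi hA fun a ha => (hQ a ha).1, fun a ha => (hQ a ha).2⟩

theorem Mem.app {A F f a : Dom} (hf : Mem f (con .pi A F)) (ha : Mem a A) :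
    Mem (app f a) (app F a) := (mem_pi_iff.1 hf).2.2 a ha

theorem mem_sigma_iff {A F p : Dom} : Mem p (con .sigma A F) ↔
    (∀ a, Mem a A → IsType (app F a)) ∧ Mem p.fst A ∧ Mem p.snd (app F p.fst) := by
  constructor
  · rintro ⟨_, h, hp⟩
    obtain ⟨P, Q, hA, hB, rfl⟩ := code_sigma h
    exact ⟨fun a ha => ⟨_, hB a (hA.mem_iff.1 ha)⟩, ⟨_, hA, hp.1⟩, ⟨_, hB _ hp.1, hp.2⟩⟩
  · rintro ⟨hF, ⟨P, hA, h₁⟩, h₂⟩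
    simp only [hA.mem_iff] at hF
    obtain ⟨Q, hQ⟩ := exists_family (p := fun _ _ => True) fun a ha =>
      (hF a ha).imp fun _ h => ⟨h, True.intro⟩
    exact ⟨_, .sigma hA fun a ha => (hQ a ha).1, h₁, (Code.mem_iff (hQ _ h₁).1).1 h₂⟩

theorem isType_sigma {A F : Dom} (h : IsType (con .sigma A F)) :
    ∀ a, Mem a A → IsType (app F a) := by
  obtain ⟨_, h⟩ := h
  obtain ⟨P, Q, hA, hB, -⟩ := code_sigma h
  exact fun a ha => ⟨_, hB a (hA.mem_iff.1 ha)⟩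

theorem mem_sum_iff {A B t : Dom} : Mem t (con .sum A B) ↔ IsType A ∧ IsType B ∧
    ((∃ a, Mem a A ∧ t = con .inl a ∅) ∨ ∃ b, Mem b B ∧ t = con .inr b ∅) := by
  constructor
  · rintro ⟨_, h, ht⟩
    obtain ⟨P, Q, hA, hB, rfl⟩ := code_sum h
    simpa only [hA.mem_iff, hB.mem_iff] using ⟨⟨P, hA⟩, ⟨Q, hB⟩, ht⟩
  · rintro ⟨⟨P, hA⟩, ⟨Q, hB⟩, ht⟩
    simp only [hA.mem_iff, hB.mem_iff] at ht
    exact ⟨_, .sum hA hB, ht⟩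

theorem isType_sum {A B : Dom} (h : IsType (con .sum A B)) : IsType A ∧ IsType B := by
  obtain ⟨_, h⟩ := h
  obtain ⟨P, Q, hA, hB, -⟩ := code_sum h
  exact ⟨⟨P, hA⟩, ⟨Q, hB⟩⟩

/-! ## Universes -/

theorem isType_of_mem_El {U : Univ} {A : Dom} (h : A ∈ El U) : IsType A := by
  obtain ⟨P, hP, -⟩ := mem_El.1 h
  exact ⟨P, hP.code⟩

theorem Cumul.rank_lt {U V : Univ} (h : Cumul U V) : U.rank < V.rank := by
  cases h <;> simp [Univ.rank, Prod.Lex.toLex_lt_toLex]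

/-- No universe is included in `Prop`, so cumulativity never has to establish the all-or-nothing
condition. -/
theorem Cumul.ne_prop {U V : Univ} (h : Cumul U V) : V ≠ .prop := by
  cases h <;> simp

theorem MemUniv.cumul {U V : Univ} (h : MemUniv U V) : Cumul U V := by
  cases h <;> constructor

theorem El_mono {U V : Univ} (h : Cumul U V) : El U ⊆ El V := by
  intro A hA
  obtain ⟨P, hP, -⟩ := mem_El.1 hA
  exact mem_El.2 ⟨P, hP.mono fun _ h' => h'.trans h.rank_lt, fun h' => (h.ne_prop h').elim⟩

theorem univ_mem_El {U V : Univ} (h : MemUniv U V) : con (.univ U) ∅ ∅ ∈ El V :=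
  mem_El.2 ⟨_, .univ U h.cumul.rank_lt, fun h' => (h.cumul.ne_prop h').elim⟩

theorem mem_El_of_code {U : Univ} (hU : U ≠ .prop) {A : Dom} {P : Set Dom}
    (h : TypeCode (fun V => V.rank < U.rank) A P) : A ∈ El U :=
  mem_El.2 ⟨P, h, fun h' => (hU h').elim⟩

theorem botCode_mem_El (U : Univ) : botCode ∈ El U :=
  mem_El.2 ⟨_, .bot, fun _ _ h => h.elim⟩

theorem trivialCode_mem_El (U : Univ) : trivialCode ∈ El U :=
  mem_El.2 ⟨_, .trivial, fun _ _ _ => rfl⟩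

theorem pi_mem_El {U : Univ} {A F : Dom} (hA : A ∈ El U) (hF : ∀ a, Mem a A → app F a ∈ El U) :
    con .pi A F ∈ El U := by
  obtain ⟨P, hP, -⟩ := mem_El.1 hA
  simp only [hP.code.mem_iff, mem_El] at hF
  obtain ⟨Q, hQ⟩ := exists_family (p := fun _ Q => U = .prop → IsProp Q) hF
  -- For `Prop`: if the product has an element, every fibre is inhabited, hence contains everything,
  -- and so does the product.
  refine mem_El.2 ⟨_, .pi hP fun a ha => (hQ a ha).1, fun hU f hf => ?_⟩
  refine Set.eq_univ_of_forall fun g a ha => ?_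
  rw [(hQ a ha).2 (by simp [hU]) _ (hf a ha)]
  exact True.intro

theorem all_mem_El {i : ℕ} {A F : Dom} (hA : A ∈ El (.uc i))
    (hF : ∀ a, Mem a A → app F a ∈ El .prop) : con .pi A F ∈ El .prop := by
  obtain ⟨P, hP, -⟩ := mem_El.1 hA
  simp only [hP.code.mem_iff, mem_El] at hF
  obtain ⟨Q, hQ⟩ := exists_family (p := fun _ Q => True → IsProp Q) hF
  -- The domain is not a proposition. Its code may be used because every `Uc_i` has smaller rank
  -- than `Prop`; the all-or-nothing condition then comes from the fibres alone.
  have hi : (Univ.uc i).rank < Univ.prop.rank := by simp [Univ.rank, Prod.Lex.toLex_lt_toLex]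
  refine mem_El.2 ⟨_, .pi (hP.mono fun _ h => h.trans hi) fun a ha => (hQ a ha).1,
    fun hU f hf => ?_⟩
  refine Set.eq_univ_of_forall fun g a ha => ?_
  rw [(hQ a ha).2 (by simp) _ (hf a ha)]
  exact True.intro

theorem sigma_mem_El {U : Univ} (hU : U ≠ .prop) {A F : Dom} (hA : A ∈ El U)
    (hF : ∀ a, Mem a A → app F a ∈ El U) : con .sigma A F ∈ El U := by
  obtain ⟨P, hP, -⟩ := mem_El.1 hA
  simp only [hP.code.mem_iff, mem_El] at hF
  obtain ⟨Q, hQ⟩ := exists_family (p := fun _ Q => U = .prop → IsProp Q) hF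
  exact mem_El_of_code hU (.sigma hP fun a ha => (hQ a ha).1)

theorem sum_mem_El {U : Univ} (hU : U ≠ .prop) {A B : Dom} (hA : A ∈ El U) (hB : B ∈ El U) :
    con .sum A B ∈ El U := by
  obtain ⟨P, hP, -⟩ := mem_El.1 hA
  obtain ⟨Q, hQ, -⟩ := mem_El.1 hB
  exact mem_El_of_code hU (.sum hP hQ)

/-- A proposition with a proof is proved by every element. -/
theorem mem_of_mem_prop {A a : Dom} (hA : A ∈ El .prop) (ha : Mem a A) (b : Dom) : Mem b A := by
  obtain ⟨P, hP, hp⟩ := mem_El.1 hA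
  rw [hP.code.mem_iff] at ha ⊢
  rw [hp rfl a ha]
  exact True.intro

/-! ## Semantic judgments -/

variable {S : Signature.{u}}

/-- The environment `ρ` satisfies the context `Γ`. -/
def Sat (Γ : Ctx S) (ρ : ℕ → Dom) : Prop := ∀ n A, Lookup Γ n A → Mem (ρ n) (A.interp ρ)

/-- Every entry of the context is a type. -/
def ValidCtx : Ctx S → Prop
  | [] => True
  | A :: Γ => ValidCtx Γ ∧ ∀ ρ, Sat Γ ρ → IsType (A.interp ρ)

/-- Validity of judgments in the model. -/
def Valid : Judgment S → Prop
  | .ctx Γ => ValidCtx Γ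
  | .tm Γ t A => ValidCtx Γ ∧ ∀ ρ, Sat Γ ρ → Mem (t.interp ρ) (A.interp ρ)
  | .eq _ t s _ => ∀ ρ, t.interp ρ = s.interp ρ

theorem Sat.cons {Γ : Ctx S} {ρ : ℕ → Dom} (h : Sat Γ ρ) {A : Tm S} {a : Dom}
    (ha : Mem a (A.interp ρ)) : Sat (A :: Γ) (Env.cons a ρ) := by
  intro n B hB
  cases hB with
  | zero => rw [Tm.interp_shift]; exact ha
  | succ _ hB => rw [Tm.interp_shift]; exact h _ _ hB

theorem sat_nil (ρ : ℕ → Dom) : Sat ([] : Ctx S) ρ := by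
  intro n A h
  cases h

/-- The premise that an operator on propositions is provably monotone. -/
abbrev monotonicity (Γ : Ctx S) (φ m : Tm S) : Judgment S :=
  .tm (φ.rename (· + 2) :: Tm.arrow (.var 1) (.var 0) :: .univ .prop :: .univ .prop :: Γ) m
    (φ.subst (Tm.scons (.var 2) fun k => .var (k + 4)))

/-- A provably monotone operator on propositions is monotone in the model. -/
theorem interp_mono {Γ : Ctx S} {φ m : Tm S}
    (h : Valid (monotonicity Γ φ m)) {ρ : ℕ → Dom} (hρ : Sat Γ ρ)
    {A B : Dom} (hA : A ∈ El .prop) (hB : B ∈ El .prop) (hAB : ∀ a, Mem a A → ∃ b, Mem b B)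
    {a : Dom} (ha : Mem a (φ.interp (Env.cons A ρ))) :
    ∃ b, Mem b (φ.interp (Env.cons B ρ)) := by
  have h₂ : Sat (.univ .prop :: .univ .prop :: Γ) (Env.cons B (Env.cons A ρ)) :=
    (hρ.cons (mem_univ_iff.2 hA)).cons (mem_univ_iff.2 hB)
  -- The empty set proves X → Y: if X has an element then so does Y, and a proposition with an
  -- element contains everything, including the values of the empty function.
  have h₃ : Mem ∅ ((Tm.arrow (.var 1) (.var 0) : Tm S).interp (Env.cons B (Env.cons A ρ))) := by
    refine mem_pi_iff.2 ⟨isType_of_mem_El hA, fun x hx => ?_, fun x hx => ?_⟩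
    · rw [app_lam (Tm.cont_interp_cons _ _), Tm.interp_shift]
      exact isType_of_mem_El hB
    · rw [app_lam (Tm.cont_interp_cons _ _), Tm.interp_shift]
      obtain ⟨b, hb⟩ := hAB x hx
      exact mem_of_mem_prop hB hb _
  -- The derivation `m` is evaluated at X := `A`, Y := `B`, h := `∅` and z := `a`. The renaming by 2
  -- skips h and Y, and variable 2 of the target is Y.
  have h₄ := h.2 _ ((h₂.cons h₃).cons (a := a) (by
    rw [Tm.interp_rename]
    convert ha using 2
    funext n
    cases n <;> rfl))
  rw [Tm.interp_subst_scons] at h₄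
  exact ⟨_, h₄⟩

/-! ## Soundness -/

@[simp] theorem app_lam_interp (t : Tm S) (ρ : ℕ → Dom) (a : Dom) :
    (Dom.lam fun x => t.interp (Env.cons x ρ)).app a = t.interp (Env.cons a ρ) :=
  app_lam (t.cont_interp_cons ρ) a

/-! ### Typing of the eliminators in the model. -/

theorem Mem.app_pi {A B : Tm S} {ρ : ℕ → Dom} {f a : Dom} (hf : Mem f ((Tm.pi A B).interp ρ))
    (ha : Mem a (A.interp ρ)) : Mem (Dom.app f a) (B.interp (Env.cons a ρ)) :=
  app_lam_interp B ρ a ▸ Mem.app hf ha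

theorem Mem.app_arrow {A B : Tm S} {ρ : ℕ → Dom} {f a : Dom}
    (hf : Mem f ((Tm.arrow A B).interp ρ)) (ha : Mem a (A.interp ρ)) :
    Mem (Dom.app f a) (B.interp ρ) :=
  Tm.interp_shift B 1 (Env.cons a ρ) ▸ hf.app_pi ha

theorem Mem.app_natStepTy {P : Tm S} {ρ : ℕ → Dom} {s n p : Dom}
    (hs : Mem s ((Tm.natStepTy P).interp ρ)) (hn : IsNat n)
    (hp : Mem p (P.interp (Env.cons n ρ))) :
    Mem (Dom.app (Dom.app s n) p) (P.interp (Env.cons (con .suc n ∅) ρ)) := by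
  have h := (hs.app_pi (mem_nat_iff.2 hn)).app_pi hp
  rw [Tm.interp_subst_scons] at h
  exact h

/-- States, events and transitions range over everything, so `e`, `σ₂` and `π` are arbitrary. This
agrees with `IsTrace.step`, which puts no condition on them. -/
theorem Mem.app_traceStepTy {P σ₀ : Tm S} {ρ : ℕ → Dom} {s σ₁ τ e σ₂ π p : Dom}
    (hs : Mem s ((Tm.traceStepTy σ₀ P).interp ρ)) (hτ : IsTrace (σ₀.interp ρ) σ₁ τ)
    (hp : Mem p (P.interp (Env.cons τ (Env.cons σ₁ ρ)))) :
    Mem (Dom.app (Dom.app (Dom.app (Dom.app (Dom.app (Dom.app s σ₁) τ) e) σ₂) π) p)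
      (P.interp (Env.cons (Dom.step σ₁ σ₂ τ e π) (Env.cons σ₂ ρ))) := by
  have h₁ := hs.app_pi (mem_trivial σ₁)
  have hτ' : Mem τ ((Tm.finTrace (σ₀.shift 1) (.var 0)).interp (Env.cons σ₁ ρ)) := by
    refine mem_finTrace_iff.2 ?_
    rw [Tm.interp_shift]
    exact hτ
  have h₂ := (((h₁.app_pi hτ').app_pi (mem_trivial e)).app_pi (mem_trivial σ₂)).app_pi
    (mem_trivial π)
  have h₃ := h₂.app_pi (a := p) (by
    rw [Tm.interp_subst_scons₂]
    exact hp)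
  rw [Tm.interp_subst_scons₂] at h₃
  exact h₃

theorem mem_case {A B C : Tm S} {ρ : ℕ → Dom} {f g t : Dom}
    (hf : Mem f ((Tm.pi A (C.subst (Tm.scons (.inl (.var 0)) fun k => .var (k + 1)))).interp ρ))
    (hg : Mem g ((Tm.pi B (C.subst (Tm.scons (.inr (.var 0)) fun k => .var (k + 1)))).interp ρ))
    (ht : Mem t ((Tm.sum A B).interp ρ)) :
    Mem (Dom.case f g t) (C.interp (Env.cons t ρ)) := by
  obtain ⟨-, -, ⟨a, ha, rfl⟩ | ⟨b, hb, rfl⟩⟩ := mem_sum_iff.1 ht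
  · have h := hf.app_pi ha
    rw [Tm.interp_subst_scons] at h
    rwa [case_inl]
  · have h := hg.app_pi hb
    rw [Tm.interp_subst_scons] at h
    rwa [case_inr]

theorem mem_natRec {P : Tm S} {ρ : ℕ → Dom} {z s n : Dom}
    (hz : Mem z (P.interp (Env.cons (con .zero ∅ ∅) ρ)))
    (hs : Mem s ((Tm.natStepTy P).interp ρ)) (hn : IsNat n) :
    Mem (Dom.natRec z s n) (P.interp (Env.cons n ρ)) := by
  induction hn with
  | zero => rwa [natRec_zero]
  | suc hn ih =>
    rw [natRec_suc]
    exact hs.app_natStepTy hn ih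

theorem mem_traceElim {P σ₀ : Tm S} {ρ : ℕ → Dom} {b s σ τ : Dom}
    (hb : Mem b (P.interp (Env.cons (con .nil (σ₀.interp ρ) ∅) (Env.cons (σ₀.interp ρ) ρ))))
    (hs : Mem s ((Tm.traceStepTy σ₀ P).interp ρ)) (hτ : IsTrace (σ₀.interp ρ) σ τ) :
    Mem (Dom.traceElim b s τ) (P.interp (Env.cons τ (Env.cons σ ρ))) := by
  induction hτ with
  | nil => rwa [traceElim_nil]
  | step hτ ih =>
    rw [traceElim_step]
    exact hs.app_traceStepTy hτ ih

theorem interp_mem_El {Γ : Ctx S} {A B : Tm S} {U : Univ}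
    (h : Valid (.tm (A :: Γ) B (.univ U))) {ρ : ℕ → Dom} (hρ : Sat Γ ρ) {a : Dom}
    (ha : Mem a (A.interp ρ)) : B.interp (Env.cons a ρ) ∈ El U :=
  mem_univ_iff.1 (h.2 _ (hρ.cons ha))

section FixedPoints

variable {Γ : Ctx S} {φ m : Tm S} {ρ : ℕ → Dom}

/-- The claim is φ(φ(⊥)) ⇒ φ(⊥). If φ(⊥) is true there is nothing to prove; otherwise φ(⊥) implies ⊥
and monotonicity applies. -/
theorem mem_mu (hφ : Valid (.tm (.univ .prop :: Γ) φ (.univ .prop)))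
    (hm : Valid (monotonicity Γ φ m)) (hρ : Sat Γ ρ) {a : Dom}
    (ha : Mem a (φ.interp (Env.cons ((Tm.mu φ).interp ρ) ρ))) (b : Dom) :
    Mem b ((Tm.mu φ).interp ρ) := by
  have h₀ := interp_mem_El hφ hρ (mem_univ_iff.2 (botCode_mem_El _))
  by_cases h : ∃ c, Mem c ((Tm.mu φ).interp ρ)
  · obtain ⟨c, hc⟩ := h
    exact mem_of_mem_prop h₀ hc b
  · obtain ⟨c, hc⟩ := interp_mono hm hρ h₀ (botCode_mem_El _) (fun c hc => (h ⟨c, hc⟩).elim) ha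
    exact mem_of_mem_prop h₀ hc b

/-- From ⊥ ⇒ Q monotonicity gives φ(⊥) ⇒ φ(Q), and `s` leads on to Q. -/
theorem mem_of_mem_mu (hm : Valid (monotonicity Γ φ m)) (hρ : Sat Γ ρ) {Q : Tm S}
    (hQ : Q.interp ρ ∈ El .prop) {s t : Dom} (hs : Mem s ((Tm.arrow (φ.inst Q) Q).interp ρ))
    (ht : Mem t ((Tm.mu φ).interp ρ)) (b : Dom) : Mem b (Q.interp ρ) := by
  obtain ⟨c, hc⟩ := interp_mono hm hρ (botCode_mem_El _) hQ (fun c hc => (mem_bot hc).elim) ht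
  rw [← Tm.interp_inst] at hc
  exact mem_of_mem_prop hQ (hs.app_arrow hc) b

/-- Once φ(⊤) is known to be true, ⊤ ⇒ φ(⊤) holds, and monotonicity turns φ(⊤) into φ(φ(⊤)). -/
theorem mem_unfold_nu (hφ : Valid (.tm (.univ .prop :: Γ) φ (.univ .prop)))
    (hm : Valid (monotonicity Γ φ m)) (hρ : Sat Γ ρ) {t : Dom}
    (ht : Mem t ((Tm.nu φ).interp ρ)) (b : Dom) :
    Mem b (φ.interp (Env.cons ((Tm.nu φ).interp ρ) ρ)) := by
  have h₁ := interp_mem_El hφ hρ (mem_univ_iff.2 (trivialCode_mem_El _))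
  obtain ⟨c, hc⟩ := interp_mono hm hρ (trivialCode_mem_El _) h₁ (fun _ _ => ⟨t, ht⟩) ht
  exact mem_of_mem_prop (interp_mem_El hφ hρ (mem_univ_iff.2 h₁)) hc b

/-- The coalgebra `s` gives φ(Q), and Q ⇒ ⊤ gives φ(⊤). -/
theorem mem_nu (hφ : Valid (.tm (.univ .prop :: Γ) φ (.univ .prop)))
    (hm : Valid (monotonicity Γ φ m)) (hρ : Sat Γ ρ) {Q : Tm S}
    (hQ : Q.interp ρ ∈ El .prop) {s t : Dom} (hs : Mem s ((Tm.arrow Q (φ.inst Q)).interp ρ))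
    (ht : Mem t (Q.interp ρ)) (b : Dom) : Mem b ((Tm.nu φ).interp ρ) := by
  have hc := hs.app_arrow ht
  rw [Tm.interp_inst] at hc
  obtain ⟨c, hc⟩ := interp_mono hm hρ hQ (trivialCode_mem_El _) (fun _ _ => ⟨∅, mem_trivial _⟩) hc
  exact mem_of_mem_prop (interp_mem_El hφ hρ (mem_univ_iff.2 (trivialCode_mem_El _))) hc b

end FixedPoints

/-- Every derivable judgment is valid in the model. -/
theorem Derivable.valid {J : Judgment S} (h : Derivable J) : Valid J := by
  induction h with
  | ctx_empty => exact True.intro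
  | ctx_ext _ _ ihΓ ihA =>
    exact And.intro ihΓ fun ρ hρ => isType_of_mem_El (mem_univ_iff.1 (ihA.2 ρ hρ))
  | var _ hn ihΓ => exact And.intro ihΓ fun ρ hρ => hρ _ _ hn
  | conv _ _ iht ihA => exact And.intro iht.1 fun ρ hρ => ihA ρ ▸ iht.2 ρ hρ
  | eq_refl => exact fun _ => rfl
  | eq_symm _ ih => exact fun ρ => (ih ρ).symm
  | eq_trans _ _ ih ih' => exact fun ρ => (ih ρ).trans (ih' ρ)
  | eq_conv _ _ ih _ => exact ih
  | eq_subst _ _ _ ih =>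
    intro ρ
    rw [Tm.interp_inst, Tm.interp_inst, ih ρ]
  -- Equations hold in every environment, also in those that do not satisfy the context, so
  -- congruence under a binder is function extensionality.
  | pi_congr _ _ ihA ihB | all_congr _ _ ihA ihB | sigma_congr _ _ _ ihA ihB =>
    simp only [Valid] at ihA ihB
    intro ρ
    simp only [Tm.interp, ihA, ihB]
  | lam_congr _ ih =>
    simp only [Valid] at ih
    intro ρ
    simp only [Tm.interp, ih]
  | mu_congr _ _ _ ih | nu_congr _ _ _ ih => exact fun ρ => ih _
  | univ_form _ hU ihΓ => exact And.intro ihΓ fun ρ _ => mem_univ_iff.2 (univ_mem_El hU)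
  | cumul _ hU ih =>
    exact And.intro ih.1 fun ρ hρ => mem_univ_iff.2 (El_mono hU (mem_univ_iff.1 (ih.2 ρ hρ)))
  | pi_form _ _ ihA ihB =>
    refine And.intro ihA.1 fun ρ hρ => mem_univ_iff.2
      (pi_mem_El (mem_univ_iff.1 (ihA.2 ρ hρ)) fun a ha => ?_)
    rw [app_lam_interp]
    exact interp_mem_El ihB hρ ha
  | all_form _ _ ihA ihB =>
    refine And.intro ihA.1 fun ρ hρ => mem_univ_iff.2
      (all_mem_El (mem_univ_iff.1 (ihA.2 ρ hρ)) fun a ha => ?_)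
    rw [app_lam_interp]
    exact interp_mem_El ihB hρ ha
  -- The rule has no formation premise for `A`; that `A` is a type comes from the validity of the
  -- extended context, which is why validity of a typing judgment includes that of its context.
  | pi_intro _ ih =>
    refine And.intro ih.1.1 fun ρ hρ =>
      mem_pi_iff.2 ⟨ih.1.2 ρ hρ, fun a ha => ?_, fun a ha => ?_⟩
    · rw [app_lam_interp]
      exact (ih.2 _ (hρ.cons ha)).isType
    · simp only [Tm.interp, app_lam_interp]
      exact ih.2 _ (hρ.cons ha)
  | pi_elim _ _ ihf iha =>
    refine And.intro ihf.1 fun ρ hρ => ?_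
    rw [Tm.interp_inst]
    exact (ihf.2 ρ hρ).app_pi (iha.2 ρ hρ)
  | pi_beta _ _ _ _ =>
    intro ρ
    rw [Tm.interp_inst]
    exact app_lam_interp _ _ _
  | sigma_form hU _ _ ihA ihB =>
    refine And.intro ihA.1 fun ρ hρ => mem_univ_iff.2
      (sigma_mem_El hU (mem_univ_iff.1 (ihA.2 ρ hρ)) fun a ha => ?_)
    rw [app_lam_interp]
    exact interp_mem_El ihB hρ ha
  | sigma_intro _ _ _ ihS iha ihb =>
    refine And.intro iha.1 fun ρ hρ => mem_sigma_iff.2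
      ⟨isType_sigma (isType_of_mem_El (mem_univ_iff.1 (ihS.2 ρ hρ))), ?_, ?_⟩
    · simpa only [Tm.interp, fst_con] using iha.2 ρ hρ
    · simpa only [Tm.interp, fst_con, snd_con, app_lam_interp, Tm.interp_inst] using ihb.2 ρ hρ
  | fst _ ih => exact And.intro ih.1 fun ρ hρ => (mem_sigma_iff.1 (ih.2 ρ hρ)).2.1
  | snd _ ih =>
    refine And.intro ih.1 fun ρ hρ => ?_
    simpa only [Tm.interp, app_lam_interp, Tm.interp_inst] using (mem_sigma_iff.1 (ih.2 ρ hρ)).2.2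
  | fst_pair => exact fun ρ => fst_con _ _ _
  | snd_pair => exact fun ρ => snd_con _ _ _
  | bot_form U _ ih => exact And.intro ih fun ρ _ => mem_univ_iff.2 (botCode_mem_El U)
  | bot_elim _ _ _ ih => exact And.intro ih.1 fun ρ hρ => (mem_bot (ih.2 ρ hρ)).elim
  | unit_form _ ih =>
    exact And.intro ih fun ρ _ => mem_univ_iff.2 (mem_El_of_code (by simp) .unit)
  | unit_intro _ ih => exact And.intro ih fun ρ _ => mem_unit_iff.2 rfl
  | unit_elim _ _ _ _ ihc iht =>
    refine And.intro ihc.1 fun ρ hρ => ?_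
    have h := ihc.2 ρ hρ
    rw [Tm.interp_inst] at h ⊢
    rw [mem_unit_iff.1 (iht.2 ρ hρ)]
    exact h
  | unit_beta => exact fun ρ => rfl
  | sum_form hU _ _ ihA ihB =>
    exact And.intro ihA.1 fun ρ hρ => mem_univ_iff.2
      (sum_mem_El hU (mem_univ_iff.1 (ihA.2 ρ hρ)) (mem_univ_iff.1 (ihB.2 ρ hρ)))
  | inl _ _ ihS ih =>
    refine And.intro ih.1 fun ρ hρ => ?_
    have h := isType_sum (isType_of_mem_El (mem_univ_iff.1 (ihS.2 ρ hρ)))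
    exact mem_sum_iff.2 ⟨h.1, h.2, .inl ⟨_, ih.2 ρ hρ, rfl⟩⟩
  | inr _ _ ihS ih =>
    refine And.intro ih.1 fun ρ hρ => ?_
    have h := isType_sum (isType_of_mem_El (mem_univ_iff.1 (ihS.2 ρ hρ)))
    exact mem_sum_iff.2 ⟨h.1, h.2, .inr ⟨_, ih.2 ρ hρ, rfl⟩⟩
  | sum_elim _ _ _ _ _ ihf ihg iht =>
    refine And.intro ihf.1 fun ρ hρ => ?_
    rw [Tm.interp_inst]
    exact mem_case (ihf.2 ρ hρ) (ihg.2 ρ hρ) (iht.2 ρ hρ)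
  | sum_beta_inl => exact fun ρ => case_inl _ _ _ _
  | sum_beta_inr => exact fun ρ => case_inr _ _ _ _
  | nat_form _ ih =>
    exact And.intro ih fun ρ _ => mem_univ_iff.2 (mem_El_of_code (by simp) .nat)
  | nat_zero _ ih => exact And.intro ih fun ρ _ => mem_nat_iff.2 .zero
  | nat_suc _ ih =>
    exact And.intro ih.1 fun ρ hρ => mem_nat_iff.2 (.suc (mem_nat_iff.1 (ih.2 ρ hρ)))
  | nat_elim _ _ _ _ _ ihz ihs ihn =>
    refine And.intro ihz.1 fun ρ hρ => ?_
    have hz := ihz.2 ρ hρ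
    rw [Tm.interp_inst] at hz ⊢
    exact mem_natRec hz (ihs.2 ρ hρ) (mem_nat_iff.1 (ihn.2 ρ hρ))
  | nat_beta_zero => exact fun ρ => natRec_zero _ _ _ _
  | nat_beta_suc => exact fun ρ => natRec_suc _ _ _ _
  | id_form hU _ _ _ ih =>
    exact And.intro ih.1 fun ρ _ => mem_univ_iff.2 (mem_El_of_code hU (.id _ _))
  | id_refl _ ih => exact And.intro ih.1 fun ρ _ => mem_id_iff.2 ⟨rfl, rfl⟩
  | id_elim _ _ _ _ _ ihd _ ihp =>
    refine And.intro ihd.1 fun ρ hρ => ?_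
    have h := ihd.2 ρ hρ
    obtain ⟨hab, hp⟩ := mem_id_iff.1 (ihp.2 ρ hρ)
    rw [Tm.interp_inst₂] at h ⊢
    -- A proof of identity forces the end points to be the same element and the proof to be `refl`,
    -- so the type of `d` is already the goal.
    rw [hp, ← hab]
    exact h
  | id_beta => exact fun ρ => rfl
  | state_form _ ih | event_form _ ih | infTrace_form _ ih =>
    exact And.intro ih fun ρ _ => mem_univ_iff.2 (trivialCode_mem_El _)
  | step_form _ _ _ ih | ext_form _ _ ih | know_form _ _ ih =>
    exact And.intro ih.1 fun ρ _ => mem_univ_iff.2 (trivialCode_mem_El _)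
  | state_const _ _ ih | event_const _ _ ih | step_const _ _ ih | know_const _ _ _ _ ih =>
    exact And.intro ih fun ρ _ => mem_trivial _
  | finTrace_form _ _ ih =>
    exact And.intro ih.1 fun ρ _ => mem_univ_iff.2 (mem_El_of_code (by simp) (.finTrace _ _))
  | trace_nil _ ih => exact And.intro ih.1 fun ρ _ => mem_finTrace_iff.2 .nil
  | trace_step _ _ _ _ _ _ _ ih =>
    exact And.intro ih.1 fun ρ hρ => mem_finTrace_iff.2 (.step (mem_finTrace_iff.1 (ih.2 ρ hρ)))
  | trace_elim _ _ _ _ _ _ _ _ _ ihb ihs ihτ =>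
    refine And.intro ihb.1 fun ρ hρ => ?_
    have hb := ihb.2 ρ hρ
    rw [Tm.interp_inst₂] at hb ⊢
    exact mem_traceElim hb (ihs.2 ρ hρ) (mem_finTrace_iff.1 (ihτ.2 ρ hρ))
  | trace_beta_nil => exact fun ρ => traceElim_nil _ _ _ _
  | trace_beta_step => exact fun ρ => traceElim_step _ _ _ _ _ _ _
  | inf_head _ ih | inf_corec _ _ _ _ _ ih | ext_id _ ih | ext_step _ _ _ _ _ ih
  | ext_comp _ _ ih | know_restrict _ _ ih => exact And.intro ih.1 fun ρ _ => mem_trivial _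
  -- Membership in a sum type `sigma` only looks at the two projections, so every element is a pair
  -- of an event and an infinite trace.
  | inf_tail _ ih =>
    refine And.intro ih.1 fun ρ _ => mem_sigma_iff.2 ⟨fun a _ => ?_, mem_trivial _, ?_⟩
    · rw [app_lam_interp]
      exact (mem_trivial ∅).isType
    · rw [app_lam_interp]
      exact mem_trivial _
  | inf_beta_head => exact fun ρ => (congrArg Dom.fst (corec_eq _ _ _)).trans (fst_con _ _ _)
  | inf_beta_tail => exact fun ρ => (congrArg Dom.snd (corec_eq _ _ _)).trans (snd_con _ _ _)
  -- Extensions form the monoid of sets of tokens under union with unit `∅`, so the category laws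
  -- hold strictly.
  | ext_id_comp => exact fun ρ => Set.empty_union _
  | ext_comp_id => exact fun ρ => Set.union_empty _
  | ext_assoc => exact fun ρ => Set.union_assoc _ _ _
  -- Restriction denotes the identity on knowledge and all knowledge constants denote `∅`, so the
  -- presheaf action is respected trivially.
  | restrict_id | restrict_comp | restrict_const => exact fun ρ => rfl
  | mu_form _ _ ih =>
    exact And.intro ih.1.1 fun ρ hρ =>
      mem_univ_iff.2 (interp_mem_El ih hρ (mem_univ_iff.2 (botCode_mem_El _)))
  | mu_in _ _ _ ihφ ihm iht =>
    refine And.intro iht.1 fun ρ hρ => ?_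
    have ht := iht.2 ρ hρ
    rw [Tm.interp_inst] at ht
    exact mem_mu ihφ ihm hρ ht _
  | mu_ind _ _ _ _ _ _ ihm ihQ ihs iht =>
    exact And.intro iht.1 fun ρ hρ =>
      mem_of_mem_mu ihm hρ (mem_univ_iff.1 (ihQ.2 ρ hρ)) (ihs.2 ρ hρ) (iht.2 ρ hρ) _
  | nu_form _ _ ih =>
    exact And.intro ih.1.1 fun ρ hρ =>
      mem_univ_iff.2 (interp_mem_El ih hρ (mem_univ_iff.2 (trivialCode_mem_El _)))
  | nu_out _ _ _ ihφ ihm iht =>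
    refine And.intro iht.1 fun ρ hρ => ?_
    rw [Tm.interp_inst]
    exact mem_unfold_nu ihφ ihm hρ (iht.2 ρ hρ) _
  | nu_coind _ _ _ _ _ ihφ ihm ihQ ihs iht =>
    exact And.intro iht.1 fun ρ hρ =>
      mem_nu ihφ ihm hρ (mem_univ_iff.1 (ihQ.2 ρ hρ)) (ihs.2 ρ hρ) (iht.2 ρ hρ) _

end DEKL

theorem mainTheorem7 (S : DEKL.Signature.{u}) :
    ¬ ∃ t : DEKL.Tm S, DEKL.Derivable (DEKL.Judgment.tm [] t DEKL.Tm.bot) := by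
  rintro ⟨t, ht⟩
  exact DEKL.mem_bot (ht.valid.2 (fun _ => ∅) (DEKL.sat_nil _))
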